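/- Let $\ell^\infty$ be the complex Banach space of bounded sequences $x=(x_n)_{n\ge 1}$ with the sup-norm, and let $c_0\subseteq \ell^\infty$ be the subspace of sequences converging to $0$. Let $w=(w_n)_{n\ge1}$ be a bounded sequence of positive real numbers and let $B_w:\ell^\infty\to\ell^\infty$ be the weighted backward shift $$B_w(x_1,x_2,x_3,\ldots)=(w_1x_2,\,w_2x_3,\,w_3x_4,\ldots).$$ For a bounded linear operator $T$ on a complex Banach space $X$ and $x\in X$, let $J_T(x)$ be the set of all $y\in X$ for which there are a strictly increasing sequence $(k_n)$ of natural numbers and a sequence $(x_n)$ in $X$ with $x_n\to x$ and $T^{k_n}x_n\to y$. Call $T$ $J$-class if $J_T(x)=X$ for some $x\in X\setminus\{0\}$, and put $A_T:=\{x\in X: J_T(x)=X\}$. Let $f$ be holomorphic on an open set $U\subseteq\mathbb{C}$ containing the spectrum $\sigma(B_w)$, and let $T:=f(B_w)$ be given by the holomorphic (Riesz–Dunford) functional calculus, that is, $$f(B_w)=\frac1{2\pi i}\oint_{|z|=R} f(z)\,(z-B_w)^{-1}\,dz$$ for any $R>0$ with $\sigma(B_w)\subseteq\{|z|<R\}$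 and $\{|z|\le R\}\subseteq U$ (such $R$ exists because $\sigma(B_w)$ is a closed disc centred at $0$, and the integral does not depend on it). If $T$ is $J$-class, then $$A_T=c_0 .$$ -/

import Mathlib

open Filter Topology Set
open scoped ENNReal

/-- The `J`-set of `x` under `T`: all `y` for which there are a strictly increasing sequence `k`
of natural numbers and a sequence `u n → x` with `T ^ (k n) (u n) → y`. -/
def JSet {X : Type*} [NormedAddCommGroup X] [NormedSpace ℂ X] (T : X →L[ℂ] X) (x : X) : Set X :=
  {y | ∃ (k : ℕ → ℕ) (u : ℕ → X), StrictMono k ∧ Tendsto u atTop (𝓝 x) ∧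
    Tendsto (fun n => (T ^ k n) (u n)) atTop (𝓝 y)}

/-- `T` is a `J`-class operator: some non-zero vector has the whole space as its `J`-set. -/
def IsJClass {X : Type*} [NormedAddCommGroup X] [NormedSpace ℂ X] (T : X →L[ℂ] X) : Prop :=
  ∃ x : X, x ≠ 0 ∧ JSet T x = univ

/-- The set `A_T` of all vectors (zero included) whose `J`-set is the whole space. -/
def JVectors {X : Type*} [NormedAddCommGroup X] [NormedSpace ℂ X] (T : X →L[ℂ] X) : Set X :=
  {x | JSet T x = univ}

/-- The complex Banach space `l^∞` of bounded sequences with the sup-norm. -/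
abbrev LInfty : Type := lp (fun _ : ℕ => ℂ) ∞

/-- The subspace `c_0` of `l^∞` of the sequences converging to zero, as a set. -/
def cZero : Set LInfty := {x | Tendsto (fun n => x n) atTop (𝓝 0)}

theorem nontrivial_LInfty : Nontrivial LInfty := ⟨lp.single ∞ 0 (1 : ℂ), 0, fun h => by
  have h2 : (lp.single ∞ 0 (1 : ℂ) : LInfty) 0 = (0 : LInfty) 0 := by rw [h]
  simp at h2⟩

theorem norm_weight_mul_le (w : ℕ → ℝ) (hpos : ∀ n, 0 < w n) (hbdd : BddAbove (range w))
    (x : LInfty) (n : ℕ) : ‖(w n : ℂ) * x (n + 1)‖ ≤ (⨆ n, w n) * ‖x‖ := by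
  rw [norm_mul, Complex.norm_real, Real.norm_of_nonneg (hpos n).le]
  exact mul_le_mul (le_ciSup hbdd n) (lp.norm_apply_le_norm ENNReal.top_ne_zero x (n + 1))
    (norm_nonneg _) ((hpos n).le.trans (le_ciSup hbdd n))

/-- The unilateral weighted backward shift
`B_w (x 0, x 1, x 2, …) = (w 0 * x 1, w 1 * x 2, …)` on `l^∞`,
for a positive bounded weight sequence `w`. -/
noncomputable def weightedBackwardShift (w : ℕ → ℝ) (hpos : ∀ n, 0 < w n)
    (hbdd : BddAbove (range w)) : LInfty →L[ℂ] LInfty :=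
  LinearMap.mkContinuous
    { toFun := fun x => ⟨fun n => (w n : ℂ) * x (n + 1), memℓp_infty
        ⟨(⨆ n, w n) * ‖x‖, by
          rintro _ ⟨n, rfl⟩
          exact norm_weight_mul_le w hpos hbdd x n⟩⟩
      map_add' := fun x y => by
        ext n
        exact mul_add _ _ _
      map_smul' := fun c x => by
        ext n
        exact mul_left_comm _ _ _ }
    (⨆ n, w n)
    (fun x => lp.norm_le_of_forall_le
      (mul_nonneg ((hpos 0).le.trans (le_ciSup hbdd 0)) (norm_nonneg _))
      (fun n => norm_weight_mul_le w hpos hbdd x n))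

theorem weightedBackwardShift_apply (w : ℕ → ℝ) (hpos : ∀ n, 0 < w n)
    (hbdd : BddAbove (range w)) (x : LInfty) (n : ℕ) :
    weightedBackwardShift w hpos hbdd x n = (w n : ℂ) * x (n + 1) := rfl

/-- The Riesz-Dunford integral `(2πi)⁻¹ ∮_{|z| = R} f(z) (z - T)⁻¹ dz`, with the circle
positively oriented. When `f` is holomorphic on an open set containing `{z | ‖z‖ ≤ R}` and
`σ(T) ⊆ {z | ‖z‖ < R}`, this circle is an admissible contour, and the integral is the operator
`f(T)` of the holomorphic functional calculus. -/
noncomputable def rieszDunford {X : Type*} [NormedAddCommGroup X] [NormedSpace ℂ X]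
    [CompleteSpace X] (f : ℂ → ℂ) (T : X →L[ℂ] X) (R : ℝ) : X →L[ℂ] X :=
  (2 * (Real.pi : ℂ) * Complex.I)⁻¹ • ∮ z in C(0, R), f z • resolvent T z

theorem weightedBackwardShift_pow_apply (w : ℕ → ℝ) (hpos : ∀ n, 0 < w n)
    (hbdd : BddAbove (range w)) (n : ℕ) (x : LInfty) (k : ℕ) :
    (weightedBackwardShift w hpos hbdd ^ n) x k =
      ((∏ j ∈ Finset.Ico k (k + n), w j : ℝ) : ℂ) * x (k + n) := by
  induction n generalizing x with
  | zero => simp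
  | succ n ih =>
    rw [pow_succ, mul_apply_eq_comp, ih, weightedBackwardShift_apply,
      ← add_assoc, Finset.prod_Ico_succ_top (Nat.le_add_right k n)]
    push_cast
    ring

/-- If `lam` is a regular point and `mu` a spectral point of `B_w`, then `‖mu‖ ≤ ‖lam‖`. -/
theorem norm_le_of_mem_spectrum_weightedBackwardShift (w : ℕ → ℝ) (hpos : ∀ n, 0 < w n)
    (hbdd : BddAbove (range w)) {lam mu : ℂ}
    (hlam : lam ∉ spectrum ℂ (weightedBackwardShift w hpos hbdd))
    (hmu : mu ∈ spectrum ℂ (weightedBackwardShift w hpos hbdd)) : ‖mu‖ ≤ ‖lam‖ := by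
  set B := weightedBackwardShift w hpos hbdd with hB
  rw [spectrum.notMem_iff] at hlam
  obtain ⟨A, hA⟩ : ∃ A : LInfty →L[ℂ] LInfty, A * (algebraMap ℂ _ lam - B) = 1 :=
    hlam.exists_left_inv
  have key : ∀ k n : ℕ, ‖lam‖ ^ k * ∏ j ∈ Finset.Ico k (k + n), w j ≤
      ‖A‖ * ‖lam‖ ^ (k + n + 1) := by
    intro k n
    set N := k + n with hN
    let v0 : ℕ → ℂ := fun i =>
      if i ≤ N then lam ^ i * ((∏ j ∈ Finset.Ico i N, w j : ℝ) : ℂ) else 0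
    have hv0 : Memℓp v0 ∞ := by
      refine memℓp_infty (Set.Finite.bddAbove ?_)
      refine (((Finset.range (N + 1)).image fun i => ‖v0 i‖) ∪ {0}).finite_toSet.subset ?_
      rintro _ ⟨i, rfl⟩
      by_cases hi : i ≤ N
      · simp only [Finset.coe_union, Finset.coe_image, Set.mem_union]
        exact Or.inl ⟨i, by simpa using Nat.lt_succ_of_le hi, rfl⟩
      · simp [v0, hi]
    let v : LInfty := ⟨v0, hv0⟩
    let e : LInfty := lp.single ∞ N (1 : ℂ)
    have hv : (algebraMap ℂ (LInfty →L[ℂ] LInfty) lam - B) v = lam ^ (N + 1) • e := by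
      ext i
      have h1 : ((algebraMap ℂ (LInfty →L[ℂ] LInfty) lam - B) v) i
          = lam * v0 i - (w i : ℂ) * v0 (i + 1) := by
        rfl
      have h2 : (lam ^ (N + 1) • e) i = lam ^ (N + 1) * (if i = N then 1 else 0) := by
        change lam ^ (N + 1) * e i = _
        congr 1
        simp only [e, lp.single_apply]
        by_cases hi : i = N
        · subst hi; simp
        · simp [hi]
      rw [h1, h2]
      simp only [v0]
      rcases lt_trichotomy i N with hi | hi | hi
      · rw [if_pos hi.le, if_pos (Nat.succ_le_of_lt hi), if_neg hi.ne,
          Finset.prod_eq_prod_Ico_succ_bot hi]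
        push_cast
        ring
      · subst hi
        simp [pow_succ, mul_comm]
      · rw [if_neg (by omega), if_neg (by omega), if_neg hi.ne']
        simp
    have hv' : v = A (lam ^ (N + 1) • e) := by
      rw [← hv, ← mul_apply_eq_comp, hA]
      rfl
    have hnv : ‖v‖ ≤ ‖A‖ * ‖lam‖ ^ (N + 1) := by
      rw [hv']
      refine (A.le_opNorm _).trans ?_
      rw [norm_smul, norm_pow]
      have : ‖e‖ = 1 := by
        simp [e, lp.norm_single (p := ∞) (by simp)]
      rw [this, mul_one]
    refine le_trans (le_of_eq ?_) ((lp.norm_apply_le_norm ENNReal.top_ne_zero v k).trans hnv)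
    change _ = ‖v0 k‖
    have hP : 0 ≤ ∏ j ∈ Finset.Ico k N, w j := Finset.prod_nonneg fun j _ => (hpos j).le
    simp only [v0, if_pos (show k ≤ N by omega), norm_mul, norm_pow, Complex.norm_real,
      Real.norm_of_nonneg hP]
  have hlam0 : 0 < ‖lam‖ := by
    rcases (norm_nonneg lam).eq_or_lt with h | h
    · have := key 0 0
      simp only [← h] at this
      norm_num at this
    · exact h
  have hprod : ∀ k n : ℕ, ∏ j ∈ Finset.Ico k (k + n), w j ≤ ‖A‖ * ‖lam‖ ^ (n + 1) := by
    intro k n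
    have h := key k n
    have h3 : ‖A‖ * ‖lam‖ ^ (k + n + 1) = ‖lam‖ ^ k * (‖A‖ * ‖lam‖ ^ (n + 1)) := by ring
    rw [h3] at h
    exact le_of_mul_le_mul_left h (pow_pos hlam0 k)
  have hpow : ∀ n : ℕ, ‖mu‖ ^ n ≤ ‖A‖ * ‖lam‖ * ‖lam‖ ^ n := by
    intro n
    have hC : 0 ≤ ‖A‖ * ‖lam‖ ^ (n + 1) := by positivity
    have h1 : ‖B ^ n‖ ≤ ‖A‖ * ‖lam‖ ^ (n + 1) := by
      refine ContinuousLinearMap.opNorm_le_bound _ hC fun x => ?_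
      refine lp.norm_le_of_forall_le (mul_nonneg hC (norm_nonneg _)) fun k => ?_
      have hP : 0 ≤ ∏ j ∈ Finset.Ico k (k + n), w j := Finset.prod_nonneg fun j _ => (hpos j).le
      rw [hB, weightedBackwardShift_pow_apply, norm_mul, Complex.norm_real,
        Real.norm_of_nonneg hP]
      exact mul_le_mul (hprod k n) (lp.norm_apply_le_norm ENNReal.top_ne_zero x _)
        (norm_nonneg _) hC
    have h2 : mu ^ n ∈ spectrum ℂ (B ^ n) := spectrum.pow_mem_pow B n hmu
    have : Nontrivial LInfty := nontrivial_LInfty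
    have h3 := spectrum.norm_le_norm_of_mem h2
    rw [norm_pow] at h3
    refine (h3.trans h1).trans (le_of_eq (by ring))
  by_contra! hlt
  have hq : 1 < ‖mu‖ / ‖lam‖ := (one_lt_div hlam0).2 hlt
  obtain ⟨n, hn⟩ := pow_unbounded_of_one_lt (‖A‖ * ‖lam‖) hq
  rw [div_pow, lt_div_iff₀ (pow_pos hlam0 n)] at hn
  exact absurd (hpow n) (not_le.2 hn)

/-- The spectrum of `B_w` is a closed disc centred at `0`. -/
theorem exists_spectrum_weightedBackwardShift_eq (w : ℕ → ℝ) (hpos : ∀ n, 0 < w n)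
    (hbdd : BddAbove (range w)) : ∃ r : ℝ, 0 ≤ r ∧
      spectrum ℂ (weightedBackwardShift w hpos hbdd) = Metric.closedBall 0 r := by
  have : Nontrivial LInfty := nontrivial_LInfty
  obtain ⟨mu, hmu, hmax⟩ := (spectrum.isCompact (𝕜 := ℂ)
    (weightedBackwardShift w hpos hbdd)).exists_isMaxOn (spectrum.nonempty _)
    continuous_norm.continuousOn
  refine ⟨‖mu‖, norm_nonneg _, Subset.antisymm (fun z hz => by simpa using hmax hz) ?_⟩
  have hball : Metric.ball (0 : ℂ) ‖mu‖ ⊆ spectrum ℂ (weightedBackwardShift w hpos hbdd) := by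
    intro z hz
    by_contra h
    have := norm_le_of_mem_spectrum_weightedBackwardShift w hpos hbdd h hmu
    rw [mem_ball_zero_iff] at hz
    exact absurd this (not_le.2 hz)
  rcases eq_or_ne ‖mu‖ 0 with h0 | h0
  · rw [h0, Metric.closedBall_zero]
    rintro _ rfl
    rwa [norm_eq_zero.1 h0] at hmu
  · rw [← closure_ball (0 : ℂ) h0]
    exact closure_minimal hball (spectrum.isClosed _)

/-- Every open neighbourhood of `σ(B_w)` contains an admissible circle, so that the
Riesz-Dunford integral over circles gives `f(B_w)` for every `f` holomorphic near `σ(B_w)`. -/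
theorem exists_admissible_radius (w : ℕ → ℝ) (hpos : ∀ n, 0 < w n)
    (hbdd : BddAbove (range w)) {U : Set ℂ} (hU : IsOpen U)
    (hσ : spectrum ℂ (weightedBackwardShift w hpos hbdd) ⊆ U) :
    ∃ R : ℝ, spectrum ℂ (weightedBackwardShift w hpos hbdd) ⊆ Metric.ball 0 R ∧
      Metric.closedBall 0 R ⊆ U := by
  obtain ⟨r, hr, h⟩ := exists_spectrum_weightedBackwardShift_eq w hpos hbdd
  rw [h] at hσ ⊢
  obtain ⟨d, hd, hsub⟩ := (isCompact_closedBall (0 : ℂ) r).exists_cthickening_subset_open hU hσ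
  refine ⟨d + r, Metric.closedBall_subset_ball (by linarith), ?_⟩
  rwa [cthickening_closedBall hd.le hr] at hsub

/-! Write `W n` for the product of the first `n` weights, `B` for the shift and `T = f(B)`. Since
`σ(B)` lies inside the contour, `T` is a norm-convergent power series in `B`; hence eigenvectors of
`B`, eigenvectors of its adjoint, and intertwining maps all carry over to `T`.

The engine is `weights_trichotomy`. For every `lam`, either the ratios `W (a + n) / W a` grow
uniformly faster than `‖lam‖ ^ n`, or they grow uniformly more slowly, or `lam` is an eigenvalue of
the adjoint of `B`. In the first case `B` has eigenvectors for all eigenvalues in a disc of radius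
larger than `‖lam‖`; in the second `lam` is not in `σ(B)`; in the third `f lam` is an eigenvalue of
the adjoint of `T`, and a `J`-vector forces `1 < ‖f lam‖` (`one_lt_norm_of_functional`).

Upper inclusion. On `l^∞ / c_0` the first case also excludes `lam` from the spectrum of the induced
operator, because modulo `c_0` the shift is inverted by a weighted forward shift whose powers are
controlled by the growth. So this spectrum consists of adjoint eigenvalues and `‖f‖ > 1` on it. The
operator induced by `T` is then invertible with powers of the inverse tending to zero, and such a
factor kills every `J`-vector.

Lower inclusion. Some `mu ∈ σ(B)` has `‖f mu‖ < 1`: otherwise, since boundary points of the disc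
`σ(B)` are adjoint eigenvalues, the maximum principle for `1 / f` gives `‖f‖ > 1` on all of `σ(B)`,
so that `0` is the only possible `J`-vector. At such a `mu` only the growth case survives. The
eigenvectors of `B` near `mu` have `T`-orbits tending to zero, and by the identity theorem their
closed span contains every unit vector, hence `c_0`. Vectors with null orbit are `J`-vectors because
`0` is one, and the set of `J`-vectors is closed. -/

/-! ### Power series functional calculus and spectral mapping in a Banach algebra -/

section BanachAlgebra

variable {A : Type*} [NormedRing A] [NormedAlgebra ℂ A] [CompleteSpace A]

/-- If the spectrum of `a` lies in an open disc, the powers of `a` are eventually dominated by a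
geometric sequence with ratio smaller than the radius of the disc. -/
theorem exists_eventually_norm_pow_le {a : A} {ρ : ℝ} (hρ : 0 < ρ)
    (ha : ∀ z ∈ spectrum ℂ a, ‖z‖ < ρ) :
    ∃ q, 0 < q ∧ q < ρ ∧ ∀ᶠ n : ℕ in atTop, ‖a ^ n‖ ≤ q ^ n := by
  rcases subsingleton_or_nontrivial A with hA | hA
  · refine ⟨ρ / 2, by positivity, by linarith, Eventually.of_forall fun n => ?_⟩
    rw [Subsingleton.elim (a ^ n) 0, norm_zero]
    positivity
  lift ρ to NNReal using hρ.le
  have h1 : spectralRadius ℂ a < (ρ : ℝ≥0∞) :=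
    spectrum.spectralRadius_lt_of_forall_lt a fun z hz => by exact_mod_cast ha z hz
  obtain ⟨q, hq1, hq2⟩ := ENNReal.lt_iff_exists_nnreal_btwn.1 h1
  have hq0 : 0 < q := by
    rcases eq_or_ne q 0 with rfl | h
    · simp at hq1
    · exact pos_iff_ne_zero.2 h
  refine ⟨q, by exact_mod_cast hq0, by exact_mod_cast hq2, ?_⟩
  filter_upwards [(spectrum.pow_norm_pow_one_div_tendsto_nhds_spectralRadius a).eventually_lt_const
    hq1, eventually_gt_atTop 0] with n hn hn0
  have h2 : ‖a ^ n‖ ^ (1 / n : ℝ) < q := by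
    rwa [← ENNReal.ofReal_coe_nnreal, ENNReal.ofReal_lt_ofReal_iff (by exact_mod_cast hq0)] at hn
  have h3 := Real.rpow_le_rpow (by positivity) h2.le (Nat.cast_nonneg n)
  rwa [← Real.rpow_mul (norm_nonneg _), one_div, inv_mul_cancel₀ (by positivity), Real.rpow_one,
    Real.rpow_natCast] at h3

/-- A geometric bound on the powers bounds the spectrum. -/
theorem norm_le_of_mem_spectrum_of_eventually {a : A} {C q : ℝ} (hq : 0 < q)
    (ha : ∀ᶠ n : ℕ in atTop, ‖a ^ n‖ ≤ C * q ^ n) {z : ℂ} (hz : z ∈ spectrum ℂ a) : ‖z‖ ≤ q := by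
  by_contra! hlt
  obtain ⟨n, hn, hn'⟩ := ((tendsto_pow_atTop_atTop_of_one_lt
    ((one_lt_div hq).2 hlt)).eventually_gt_atTop (C * ‖(1 : A)‖)).and ha |>.exists
  have h1 := spectrum.norm_le_norm_mul_of_mem (spectrum.pow_mem_pow a n hz)
  rw [norm_pow] at h1
  rw [div_pow, lt_div_iff₀ (pow_pos hq n)] at hn
  have h2 : ‖a ^ n‖ * ‖(1 : A)‖ ≤ C * q ^ n * ‖(1 : A)‖ :=
    mul_le_mul_of_nonneg_right hn' (norm_nonneg _)
  nlinarith

/-- The coefficients of the power series of a function holomorphic near a disc. -/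
noncomputable def cauchyCoeff (f : ℂ → ℂ) (R : ℝ) (n : ℕ) : ℂ :=
  (2 * (Real.pi : ℂ) * Complex.I)⁻¹ * ∮ z in C(0, R), f z * (z ^ (n + 1))⁻¹

theorem resolvent_eq_tsum {b : A} {z : ℂ} (hz : z ≠ 0)
    (hb : Summable fun n : ℕ => ‖b ^ n‖ * (‖z‖ ^ n)⁻¹) :
    resolvent b z = ∑' n : ℕ, (z ^ (n + 1))⁻¹ • b ^ n := by
  set x : A := z⁻¹ • b
  have hx : Summable fun n : ℕ => x ^ n := by
    refine Summable.of_norm (hb.congr fun n => ?_)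
    rw [smul_pow, norm_smul, norm_pow z⁻¹, norm_inv, mul_comm, inv_pow]
  have h1 : algebraMap ℂ A z - b = z • (1 - x) := by
    rw [smul_sub, smul_smul, mul_inv_cancel₀ hz, one_smul, Algebra.algebraMap_eq_smul_one]
  have h2 : ∑' n : ℕ, (z ^ (n + 1))⁻¹ • b ^ n = z⁻¹ • ∑' n, x ^ n := by
    rw [← hx.tsum_const_smul]
    congr 1 with n
    rw [smul_pow, smul_smul, pow_succ, mul_inv, inv_pow, mul_comm]
  let u : Aˣ := ⟨algebraMap ℂ A z - b, z⁻¹ • ∑' n, x ^ n, by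
    rw [h1, smul_mul_smul_comm, hx.one_sub_mul_tsum_pow, mul_inv_cancel₀ hz, one_smul], by
    rw [h1, smul_mul_smul_comm, hx.tsum_pow_mul_one_sub, inv_mul_cancel₀ hz, one_smul]⟩
  rw [h2, resolvent]
  exact Ring.inverse_unit u

theorem norm_cauchyCoeff_le {f : ℂ → ℂ} {R M : ℝ} (hR : 0 < R)
    (hM : ∀ z ∈ Metric.sphere (0 : ℂ) R, ‖f z‖ ≤ M) (n : ℕ) :
    ‖cauchyCoeff f R n‖ ≤ M * (R ^ n)⁻¹ := by
  have h := circleIntegral.norm_two_pi_i_inv_smul_integral_le_of_norm_le_const (c := 0)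
    (f := fun z => f z * (z ^ (n + 1))⁻¹) (C := M * (R ^ (n + 1))⁻¹) hR.le (fun z hz => by
      have hz' : ‖z‖ = R := by simpa using hz
      rw [norm_mul, norm_inv, norm_pow, hz']
      exact mul_le_mul_of_nonneg_right (hM z hz) (by positivity))
  rw [smul_eq_mul] at h
  refine h.trans (le_of_eq ?_)
  rw [pow_succ]
  field_simp

/-- The Riesz-Dunford integral over a circle is a power series in the element. -/
theorem hasSum_cauchyCoeff_smul_pow {f : ℂ → ℂ} {R : ℝ} (hR : 0 < R)
    (hf : ContinuousOn f (Metric.sphere 0 R)) {b : A}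
    (hb : Summable fun n : ℕ => ‖b ^ n‖ * (R ^ n)⁻¹) :
    (Summable fun n : ℕ => ‖cauchyCoeff f R n‖ * ‖b ^ n‖) ∧
    HasSum (fun n : ℕ => cauchyCoeff f R n • b ^ n)
      ((2 * (Real.pi : ℂ) * Complex.I)⁻¹ • ∮ z in C(0, R), f z • resolvent b z) := by
  obtain ⟨M, hM⟩ := (isCompact_sphere (0 : ℂ) R).exists_bound_of_continuousOn hf
  have hs : Summable fun n : ℕ => ‖cauchyCoeff f R n‖ * ‖b ^ n‖ := by
    refine Summable.of_nonneg_of_le (fun n => by positivity) (fun n => ?_) (hb.mul_left M)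
    have := mul_le_mul_of_nonneg_right (norm_cauchyCoeff_le hR hM n) (norm_nonneg (b ^ n))
    linarith
  refine ⟨hs, ?_⟩
  have hne : ∀ z ∈ Metric.sphere (0 : ℂ) R, z ≠ 0 := fun z hz => by
    rintro rfl
    simp at hz
    exact hR.ne hz
  have hcoef : ∀ n : ℕ, ContinuousOn (fun z : ℂ => f z * (z ^ (n + 1))⁻¹) (Metric.sphere 0 R) :=
    fun n => hf.mul ((continuous_pow (n + 1)).continuousOn.inv₀ fun z hz => pow_ne_zero _ (hne z hz))
  have hunif : TendstoUniformlyOn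
      (fun N z => ∑ n ∈ Finset.range N, (f z * (z ^ (n + 1))⁻¹) • b ^ n)
      (fun z => ∑' n : ℕ, (f z * (z ^ (n + 1))⁻¹) • b ^ n) atTop (Metric.sphere (0 : ℂ) R) := by
    refine tendstoUniformlyOn_tsum_nat (hb.mul_left (M * R⁻¹)) fun n z hz => ?_
    have hz' : ‖z‖ = R := by simpa using hz
    rw [norm_smul, norm_mul, norm_inv, norm_pow, hz']
    have := mul_le_mul_of_nonneg_right (hM z hz)
      (show 0 ≤ (R ^ (n + 1))⁻¹ * ‖b ^ n‖ by positivity)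
    calc _ = ‖f z‖ * ((R ^ (n + 1))⁻¹ * ‖b ^ n‖) := by ring
      _ ≤ _ := this
      _ = _ := by rw [pow_succ, mul_inv]; ring
  have hlim := hunif.tendsto_circleIntegral_of_continuousOn hR.le
    (Eventually.of_forall fun N => continuousOn_finsetSum _ fun n _ =>
      (hcoef n).smul continuousOn_const)
  have hres : (∮ z in C(0, R), ∑' n : ℕ, (f z * (z ^ (n + 1))⁻¹) • b ^ n) =
      ∮ z in C(0, R), f z • resolvent b z := by
    refine circleIntegral.integral_congr hR.le fun z hz => ?_
    have hz' : ‖z‖ = R := by simpa using hz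
    have hsz : Summable fun n : ℕ => (z ^ (n + 1))⁻¹ • b ^ n := by
      refine Summable.of_norm ((hb.mul_left R⁻¹).congr fun n => ?_)
      rw [norm_smul, norm_inv, norm_pow z, hz', pow_succ, mul_inv]
      ring
    rw [resolvent_eq_tsum (hne z hz) (by rwa [hz']), ← hsz.tsum_const_smul]
    simp only [smul_smul]
  rw [hres] at hlim
  have hsum : Summable fun n : ℕ => cauchyCoeff f R n • b ^ n :=
    Summable.of_norm (hs.congr fun n => (norm_smul _ _).symm)
  rw [hsum.hasSum_iff_tendsto_nat]
  refine (hlim.const_smul (2 * (Real.pi : ℂ) * Complex.I)⁻¹).congr fun N => ?_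
  rw [circleIntegral.integral_fun_sum fun n _ =>
    ((hcoef n).smul continuousOn_const).circleIntegrable hR.le, Finset.smul_sum]
  refine Finset.sum_congr rfl fun n _ => ?_
  rw [cauchyCoeff, mul_smul, ← circleIntegral.integral_smul_const]
  rfl

/-- A function holomorphic near a closed disc is the sum of its power series. -/
theorem hasSum_cauchyCoeff_mul_pow {f : ℂ → ℂ} {R : ℝ} (hR : 0 < R)
    (hf : DifferentiableOn ℂ f (Metric.closedBall 0 R)) {z : ℂ} (hz : ‖z‖ < R) :
    HasSum (fun n : ℕ => cauchyCoeff f R n * z ^ n) (f z) := by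
  have hb : Summable fun n : ℕ => ‖z ^ n‖ * (R ^ n)⁻¹ := by
    refine (summable_geometric_of_lt_one (by positivity) ((div_lt_one hR).2 hz)).congr fun n => ?_
    rw [norm_pow, div_pow, div_eq_mul_inv]
  convert! (hasSum_cauchyCoeff_smul_pow hR
    (hf.continuousOn.mono Metric.sphere_subset_closedBall) hb).2 using 1
  have h := hf.circleIntegral_sub_inv_smul (w := z) (by simpa using hz)
  have h2 : (∮ w in C(0, R), f w • resolvent z w) = ∮ w in C(0, R), (w - z)⁻¹ • f w := by
    congr 1 with w
    simp [resolvent, mul_comm]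
  rw [h2, h, smul_smul, inv_mul_cancel₀ Complex.two_pi_I_ne_zero, one_smul]

/-- One half of the spectral mapping theorem for a power series in `b`. -/
theorem notMem_spectrum_of_hasSum {b t : A} {c : ℕ → ℂ} {f : ℂ → ℂ} {mu : ℂ}
    (hc : Summable fun n => ‖c n‖ * ‖b ^ n‖) (ht : HasSum (fun n => c n • b ^ n) t)
    (hf : ∀ z ∈ spectrum ℂ b, HasSum (fun n => c n * z ^ n) (f z))
    (hcont : ContinuousOn f (spectrum ℂ b)) (hmu : ∀ z ∈ spectrum ℂ b, f z ≠ mu) :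
    mu ∉ spectrum ℂ t := by
  rcases subsingleton_or_nontrivial A with hA | hA
  · simp [spectrum.of_subsingleton]
  obtain ⟨δ, hδ, hδf⟩ : ∃ δ > 0, ∀ z ∈ spectrum ℂ b, δ ≤ ‖f z - mu‖ := by
    obtain ⟨z0, hz0, hmin⟩ := (spectrum.isCompact (𝕜 := ℂ) b).exists_isMinOn (spectrum.nonempty b)
      (hcont.sub continuousOn_const).norm
    exact ⟨_, norm_pos_iff.2 (sub_ne_zero.2 (hmu z0 hz0)), fun z hz => hmin hz⟩
  -- The norm of `1` need not be `1`, so spectral points of `b ^ n` are only bounded by `‖b ^ n‖ *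
  -- ‖1‖`; `K` absorbs this factor.
  set K := max ‖(1 : A)‖ 1
  have hK1 : 1 ≤ K := le_max_right _ _
  obtain ⟨N, hN⟩ : ∃ N, ∑' n, ‖c (n + N)‖ * ‖b ^ (n + N)‖ < δ / (2 * K) :=
    ((tendsto_sum_nat_add fun n => ‖c n‖ * ‖b ^ n‖).eventually_lt_const
      (show 0 < δ / (2 * K) by positivity)).exists
  have htail : Summable fun n => ‖c (n + N)‖ * ‖b ^ (n + N)‖ := (summable_nat_add_iff N).2 hc
  -- Truncation reduces to polynomials, where spectral mapping is available: `p(b)` is within `δ /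
  -- 2` of `t - mu`, while `‖p‖ > δ / 2` on the spectrum of `b`.
  let p : Polynomial ℂ := ∑ n ∈ Finset.range N, Polynomial.C (c n) * Polynomial.X ^ n
    - Polynomial.C mu
  have hpev : ∀ z, p.eval z = ∑ n ∈ Finset.range N, c n * z ^ n - mu := fun z => by
    simp [p, Polynomial.eval_finsetSum]
  have hpb : Polynomial.aeval b p = ∑ n ∈ Finset.range N, c n • b ^ n - algebraMap ℂ A mu := by
    simp [p, Algebra.smul_def]
  have hE : ‖t - algebraMap ℂ A mu - Polynomial.aeval b p‖ < δ / 2 := by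
    have h1 : t - algebraMap ℂ A mu - Polynomial.aeval b p = ∑' n, c (n + N) • b ^ (n + N) := by
      rw [hpb, ← ht.tsum_eq, ← ht.summable.sum_add_tsum_nat_add N]
      abel
    rw [h1]
    refine (tsum_of_norm_bounded htail.hasSum fun n => (norm_smul _ _).le).trans_lt
      (hN.trans_le ?_)
    exact div_le_div_of_nonneg_left hδ.le (by norm_num) (by linarith)
  have hpz : ∀ z ∈ spectrum ℂ b, δ / 2 < ‖p.eval z‖ := by
    intro z hz
    have h1 : f z - mu - p.eval z = ∑' n, c (n + N) * z ^ (n + N) := by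
      rw [hpev, ← (hf z hz).tsum_eq, ← (hf z hz).summable.sum_add_tsum_nat_add N]
      ring
    have h2 : ‖f z - mu - p.eval z‖ < δ / 2 := by
      rw [h1]
      refine (tsum_of_norm_bounded (htail.mul_right K).hasSum fun n => ?_).trans_lt ?_
      · have h3 := spectrum.norm_le_norm_mul_of_mem (spectrum.pow_mem_pow b (n + N) hz)
        rw [norm_mul, mul_assoc]
        refine mul_le_mul_of_nonneg_left (h3.trans ?_) (norm_nonneg _)
        exact mul_le_mul_of_nonneg_left (le_max_left _ _) (norm_nonneg _)
      · rw [tsum_mul_right]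
        calc _ < δ / (2 * K) * K := mul_lt_mul_of_pos_right hN (by linarith)
          _ = δ / 2 := by field_simp
    have h3 := norm_sub_norm_le (f z - mu) (p.eval z)
    linarith [hδf z hz]
  have hpspec : ∀ z ∈ spectrum ℂ (Polynomial.aeval b p), δ / 2 < ‖z‖ := by
    rw [spectrum.map_polynomial_aeval]
    rintro _ ⟨z, hz, rfl⟩
    exact hpz z hz
  have hpu : IsUnit (Polynomial.aeval b p) := by
    by_contra h
    have := hpspec 0 ((spectrum.zero_mem_iff ℂ).2 h)
    simp at this
    linarith
  obtain ⟨u, hu⟩ := hpu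
  have huinv : ∀ z ∈ spectrum ℂ (↑u⁻¹ : A), ‖z‖ < 2 / δ := by
    intro z hz
    rw [← spectrum.map_inv, Set.mem_inv, hu] at hz
    have h1 := hpspec _ hz
    rw [norm_inv] at h1
    have hz0 : 0 < ‖z‖ := by
      rcases (norm_nonneg z).eq_or_lt with h | h
      · rw [← h] at h1
        simp at h1
        linarith
      · exact h
    rw [lt_div_iff₀ hδ]
    rw [lt_inv_comm₀ (by positivity) hz0, inv_div] at h1
    rwa [← lt_div_iff₀ hδ]
  obtain ⟨q, hq0, hq, hqn⟩ := exists_eventually_norm_pow_le (by positivity) huinv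
  set E := t - algebraMap ℂ A mu - Polynomial.aeval b p with hEdef
  have hbt : Commute b t := by
    rw [← ht.tsum_eq]
    refine Commute.tsum_right b fun n => ?_
    exact ((Commute.refl b).pow_right n).smul_right (c n)
  have hcomm : Commute (Polynomial.aeval b p) E := by
    have h1 : Commute (Polynomial.aeval b p) t := by
      rw [hpb]
      refine Commute.sub_left (Commute.sum_left _ _ _ fun n _ => ?_) (Algebra.commutes _ _)
      exact (hbt.pow_left n).smul_left _
    exact (h1.sub_right (Algebra.commutes _ _).symm).sub_right (Commute.refl _)
  have hcomm' : Commute (↑u⁻¹ : A) E := by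
    rw [← hu] at hcomm
    exact hcomm.units_inv_left
  -- Only the spectral radius of `u⁻¹` is controlled, not its norm. Commutation with `E` is what
  -- lets the estimate be made on powers, with ratio `q * (δ / 2) < 1`.
  have hpow : ∀ᶠ n : ℕ in atTop, ‖(↑u⁻¹ * E) ^ n‖ ≤ 1 * (q * (δ / 2)) ^ n := by
    filter_upwards [hqn, eventually_gt_atTop 0] with n hn hn0
    rw [hcomm'.mul_pow, one_mul, mul_pow]
    refine (norm_mul_le _ _).trans (mul_le_mul hn ?_ (norm_nonneg _) (by positivity))
    exact (norm_pow_le' E hn0).trans (pow_le_pow_left₀ (norm_nonneg _) hE.le n)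
  have h1 : (-1 : ℂ) ∉ spectrum ℂ (↑u⁻¹ * E) := by
    intro h
    have h2 := norm_le_of_mem_spectrum_of_eventually (by positivity) hpow h
    rw [norm_neg, norm_one] at h2
    rw [lt_div_iff₀ hδ] at hq
    linarith
  rw [spectrum.notMem_iff] at h1 ⊢
  have h2 : algebraMap ℂ A mu - t = u * (algebraMap ℂ A (-1) - ↑u⁻¹ * E) := by
    rw [mul_sub, Units.mul_inv_cancel_left, map_neg, map_one, mul_neg, mul_one, hEdef, hu]
    abel
  rw [h2]
  exact u.isUnit.mul h1

/-- If `f` is larger than one in modulus on the spectrum of `b`, then `f(b)` is invertible and the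
powers of its inverse tend to zero. -/
theorem exists_unit_tendsto_inv_pow {b t : A} {c : ℕ → ℂ} {f : ℂ → ℂ}
    (hc : Summable fun n => ‖c n‖ * ‖b ^ n‖) (ht : HasSum (fun n => c n • b ^ n) t)
    (hf : ∀ z ∈ spectrum ℂ b, HasSum (fun n => c n * z ^ n) (f z))
    (hcont : ContinuousOn f (spectrum ℂ b)) (hmu : ∀ z ∈ spectrum ℂ b, 1 < ‖f z‖) :
    ∃ u : Aˣ, ↑u = t ∧ Tendsto (fun n : ℕ => (↑u⁻¹ : A) ^ n) atTop (𝓝 0) := by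
  have hspec : ∀ z ∈ spectrum ℂ t, 1 < ‖z‖ := by
    intro z hz
    by_contra! hle
    refine notMem_spectrum_of_hasSum hc ht hf hcont (fun y hy hyz => ?_) hz
    have := hmu y hy
    rw [hyz] at this
    linarith
  have htu : IsUnit t := by
    by_contra h
    have := hspec 0 ((spectrum.zero_mem_iff ℂ).2 h)
    norm_num at this
  obtain ⟨u, rfl⟩ := htu
  refine ⟨u, rfl, ?_⟩
  have huinv : ∀ z ∈ spectrum ℂ (↑u⁻¹ : A), ‖z‖ < 1 := by
    intro z hz
    rw [← spectrum.map_inv, Set.mem_inv] at hz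
    have h1 := hspec _ hz
    rw [norm_inv] at h1
    exact (one_lt_inv_iff₀.1 h1).2
  obtain ⟨q, hq0, hq, hqn⟩ := exists_eventually_norm_pow_le one_pos huinv
  exact squeeze_zero_norm' hqn (tendsto_pow_atTop_nhds_zero_of_lt_one hq0.le hq)

end BanachAlgebra

/-! ### `J`-vectors, factors of the operator, and adjoint eigenvalues -/

section JClass

variable {X : Type*} [NormedAddCommGroup X] [NormedSpace ℂ X] {T : X →L[ℂ] X}

theorem mem_JSet_iff {x y : X} : y ∈ JSet T x ↔
    ∀ ε > 0, ∀ N : ℕ, ∃ k ≥ N, ∃ u : X, ‖u - x‖ < ε ∧ ‖(T ^ k) u - y‖ < ε := by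
  constructor
  · rintro ⟨k, u, hk, hu, hTu⟩ ε hε N
    obtain ⟨n, ⟨h1, h2⟩, h3⟩ := (((tendsto_iff_norm_sub_tendsto_zero.1 hu).eventually_lt_const
      hε).and ((tendsto_iff_norm_sub_tendsto_zero.1 hTu).eventually_lt_const hε)).and
      (eventually_ge_atTop N) |>.exists
    exact ⟨k n, h3.trans (hk.id_le n), u n, h1, h2⟩
  · intro h
    obtain ⟨k, hk, hP⟩ := extraction_forall_of_frequently
      (P := fun n k => ∃ u : X, ‖u - x‖ < 1 / ((n : ℝ) + 1) ∧ ‖(T ^ k) u - y‖ < 1 / ((n : ℝ) + 1))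
      fun n => frequently_atTop.2 fun N => h _ (by positivity) N
    choose u hu using hP
    refine ⟨k, u, hk, ?_, ?_⟩
    · exact tendsto_iff_norm_sub_tendsto_zero.2 (squeeze_zero (fun _ => norm_nonneg _)
        (fun n => (hu n).1.le) tendsto_one_div_add_atTop_nhds_zero_nat)
    · exact tendsto_iff_norm_sub_tendsto_zero.2 (squeeze_zero (fun _ => norm_nonneg _)
        (fun n => (hu n).2.le) tendsto_one_div_add_atTop_nhds_zero_nat)

theorem mem_JVectors_iff {x : X} : x ∈ JVectors T ↔
    ∀ y : X, ∀ ε > 0, ∀ N : ℕ, ∃ k ≥ N, ∃ u : X, ‖u - x‖ < ε ∧ ‖(T ^ k) u - y‖ < ε := by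
  simp only [JVectors, mem_ofPred_eq, eq_univ_iff_forall, mem_JSet_iff]

theorem isClosed_JVectors : IsClosed (JVectors T) := by
  refine isClosed_of_closure_subset fun x hx => mem_JVectors_iff.2 fun y ε hε N => ?_
  obtain ⟨x', hx', hd⟩ := Metric.mem_closure_iff.1 hx (ε / 2) (by positivity)
  obtain ⟨k, hk, u, h1, h2⟩ := mem_JVectors_iff.1 hx' y (ε / 2) (by positivity) N
  refine ⟨k, hk, u, ?_, by linarith⟩
  rw [dist_comm, dist_eq_norm] at hd
  calc ‖u - x‖ = ‖(u - x') + (x' - x)‖ := by rw [sub_add_sub_cancel]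
    _ ≤ ‖u - x'‖ + ‖x' - x‖ := norm_add_le _ _
    _ < ε := by linarith

/-- By homogeneity: approximate `c⁻¹ • y` from near `x`, then multiply by a small `c`, which moves
the starting point near `0`. -/
theorem zero_mem_JVectors {x : X} (hx : x ∈ JVectors T) : (0 : X) ∈ JVectors T := by
  refine mem_JVectors_iff.2 fun y ε hε N => ?_
  set c : ℝ := min 1 (ε / (1 + ‖x‖)) with hc
  have hc0 : 0 < c := by positivity
  have hc1 : c * (1 + ‖x‖) ≤ ε := by
    rw [← le_div_iff₀ (by positivity)]
    exact min_le_right _ _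
  have hcc : (c : ℂ) ≠ 0 := by exact_mod_cast hc0.ne'
  have hcn : ‖(c : ℂ)‖ = c := by rw [Complex.norm_real, Real.norm_of_nonneg hc0.le]
  obtain ⟨k, hk, u, h1, h2⟩ := mem_JVectors_iff.1 hx ((c : ℂ)⁻¹ • y) (min 1 ε) (by positivity) N
  refine ⟨k, hk, (c : ℂ) • u, ?_, ?_⟩
  · rw [sub_zero, norm_smul, hcn]
    refine lt_of_lt_of_le (mul_lt_mul_of_pos_left ?_ hc0) hc1
    have h3 : ‖u‖ ≤ ‖u - x‖ + ‖x‖ := by simpa using norm_add_le (u - x) x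
    linarith [h1.trans_le (min_le_left _ _)]
  · have h3 : (T ^ k) ((c : ℂ) • u) - y = (c : ℂ) • ((T ^ k) u - (c : ℂ)⁻¹ • y) := by
      rw [smul_sub, smul_inv_smul₀ hcc, map_smul]
    rw [h3, norm_smul, hcn]
    have h4 := h2.trans_le (min_le_right _ _)
    have h5 : c ≤ 1 := min_le_left _ _
    nlinarith [norm_nonneg ((T ^ k) u - (c : ℂ)⁻¹ • y)]

/-- Vectors with orbit tending to zero have the same `J`-set as zero. -/
theorem mem_JVectors_of_tendsto {z : X} (h0 : (0 : X) ∈ JVectors T)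
    (hz : Tendsto (fun k : ℕ => (T ^ k) z) atTop (𝓝 0)) : z ∈ JVectors T := by
  refine mem_JVectors_iff.2 fun y ε hε N => ?_
  obtain ⟨N', hN'⟩ := eventually_atTop.1
    ((tendsto_zero_iff_norm_tendsto_zero.1 hz).eventually_lt_const (half_pos hε))
  obtain ⟨k, hk, u, h1, h2⟩ := mem_JVectors_iff.1 h0 y (ε / 2) (by positivity) (max N N')
  refine ⟨k, (le_max_left _ _).trans hk, u + z, ?_, ?_⟩
  · rw [add_sub_cancel_right, ← sub_zero u]
    linarith
  · have h3 := hN' k ((le_max_right _ _).trans hk)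
    calc ‖(T ^ k) (u + z) - y‖ = ‖((T ^ k) u - y) + (T ^ k) z‖ := by
          rw [map_add]
          abel_nf
      _ ≤ _ := norm_add_le _ _
      _ < ε := by linarith

theorem apply_pow_eq_of_semiconj {Y : Type*} [NormedAddCommGroup Y] [NormedSpace ℂ Y]
    {t : Y →L[ℂ] Y} {q : X →L[ℂ] Y} (hq : ∀ x, q (T x) = t (q x)) (n : ℕ) (x : X) :
    q ((T ^ n) x) = (t ^ n) (q x) := by
  induction n generalizing x with
  | zero => rfl
  | succ n ih =>
    rw [pow_succ, pow_succ]
    change q ((T ^ n) (T x)) = (t ^ n) (t (q x))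
    rw [ih, hq]

/-- Eigenvalues of the adjoint of a `J`-class operator lie outside the closed unit disc. -/
theorem one_lt_norm_of_functional {x : X} (hx : x ∈ JVectors T) {φ : X →L[ℂ] ℂ} {v : X}
    (hφ : φ v ≠ 0) {mu : ℂ} (hmu : ∀ x, φ (T x) = mu * φ x) : 1 < ‖mu‖ := by
  by_contra! hle
  have hpow : ∀ (n : ℕ) (x : X), φ ((T ^ n) x) = mu ^ n * φ x := fun n x => by
    rw [apply_pow_eq_of_semiconj (t := mu • ContinuousLinearMap.id ℂ ℂ) (q := φ)
      (fun x => by simp [hmu]), smul_pow]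
    simp [← ContinuousLinearMap.one_def]
  -- Since `‖mu‖ ≤ 1`, `φ` cannot grow along orbits, so it would be bounded on the `J`-set of `x`,
  -- which is the whole space.
  have hbound : ∀ y : X, ‖φ y‖ ≤ ‖φ x‖ := by
    intro y
    have hy : y ∈ JSet T x := by
      rw [show JSet T x = univ from hx]
      trivial
    obtain ⟨k, u, -, hu, hTu⟩ := hy
    refine le_of_tendsto_of_tendsto ((φ.continuous.tendsto y).comp hTu).norm
      ((φ.continuous.tendsto x).comp hu).norm (Eventually.of_forall fun n => ?_)
    simp only [Function.comp_apply, hpow, norm_mul, norm_pow]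
    exact mul_le_of_le_one_left (norm_nonneg _) (pow_le_one₀ (norm_nonneg _) hle)
  have h := hbound (((‖φ x‖ + 1 : ℝ) : ℂ) • (φ v)⁻¹ • v)
  rw [map_smul, map_smul, smul_eq_mul, smul_eq_mul, inv_mul_cancel₀ hφ, mul_one,
    Complex.norm_real, Real.norm_of_nonneg (by positivity)] at h
  linarith

/-- A factor of `T` that is invertible with powers of the inverse tending to zero annihilates every
vector with full `J`-set. -/
theorem apply_eq_zero_of_mem_JVectors {Y : Type*} [NormedAddCommGroup Y] [NormedSpace ℂ Y]
    {u : (Y →L[ℂ] Y)ˣ} {q : X →L[ℂ] Y} (hq : ∀ x, q (T x) = (u : Y →L[ℂ] Y) (q x))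
    (hu : Tendsto (fun n : ℕ => (↑u⁻¹ : Y →L[ℂ] Y) ^ n) atTop (𝓝 0))
    {x : X} (hx : x ∈ JVectors T) : q x = 0 := by
  have hy : (0 : X) ∈ JSet T x := by
    rw [show JSet T x = univ from hx]
    trivial
  obtain ⟨k, v, hk, hv, hTv⟩ := hy
  -- Running the factor backwards from a bounded sequence of endpoints contracts it to zero, whereas
  -- `q (v n)` tends to `q x`.
  have h1 : ∀ n, q (v n) = ((↑u⁻¹ : Y →L[ℂ] Y) ^ k n) (q ((T ^ k n) (v n))) := fun n => by
    have h2 : (↑u⁻¹ : Y →L[ℂ] Y) ^ k n * (u : Y →L[ℂ] Y) ^ k n = 1 := by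
      rw [← Units.val_pow_eq_pow_val, ← Units.val_pow_eq_pow_val, ← Units.val_mul, inv_pow,
        inv_mul_cancel, Units.val_one]
    rw [apply_pow_eq_of_semiconj hq]
    exact (DFunLike.congr_fun h2 (q (v n))).symm
  refine tendsto_nhds_unique ((q.continuous.tendsto x).comp hv) ?_
  have h3 : Tendsto (fun n => ((↑u⁻¹ : Y →L[ℂ] Y) ^ k n) (q ((T ^ k n) (v n)))) atTop
      (𝓝 ((0 : Y →L[ℂ] Y) (q 0))) := by
    have h4 : Tendsto (fun n => (↑u⁻¹ : Y →L[ℂ] Y) ^ k n) atTop (𝓝 0) := hu.comp hk.tendsto_atTop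
    exact (isBoundedBilinearMap_apply (𝕜 := ℂ) (E := Y) (F := Y)).continuous.tendsto (0, q 0)
      |>.comp (h4.prodMk_nhds ((q.continuous.tendsto 0).comp hTv))
  simp only [← h1, zero_apply] at h3
  exact h3

/-- Hahn-Banach: an operator whose range is not dense is annihilated by a non-zero functional. -/
theorem exists_functional_of_norm_sub_ge {S : X →L[ℂ] X} {v : X} {δ : ℝ} (hδ : 0 < δ)
    (hv : ∀ y, δ ≤ ‖v - S y‖) : ∃ φ : X →L[ℂ] ℂ, φ v ≠ 0 ∧ ∀ y, φ (S y) = 0 := by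
  set M := S.range.topologicalClosure
  have : IsClosed (M : Set X) := S.range.isClosed_topologicalClosure
  have hvM : v ∉ M := by
    intro h
    obtain ⟨_, ⟨y, rfl⟩, hy⟩ := Metric.mem_closure_iff.1 h δ hδ
    rw [dist_eq_norm] at hy
    exact absurd (hv y) (not_le.2 hy)
  obtain ⟨ψ, hψ⟩ := SeparatingDual.exists_ne_zero (R := ℂ) (x := M.mkQL v)
    (by simpa using hvM)
  refine ⟨ψ.comp M.mkQL, hψ, fun y => ?_⟩
  have : M.mkQL (S y) = 0 := by
    simpa using S.range.le_topologicalClosure ⟨y, rfl⟩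
  simp [this]

end JClass

/-! ### Exponential dichotomy for positive sequences -/

/-- A positive sequence without long flat stretches either decays or grows exponentially, uniformly
in the starting point. -/
theorem exponential_dichotomy {p : ℕ → ℝ} (hp : ∀ n, 0 < p n) {ε : ℝ} (hε : 0 < ε)
    (h : ∀ a b, a < b → ε * ∑ j ∈ Finset.Ico a b, p j ≤ p a + p b) :
    (∃ q C, 0 < q ∧ q < 1 ∧ ∀ a n, p (a + n) ≤ C * q ^ n * p a) ∨
    (∃ q c, 1 < q ∧ 0 < c ∧ ∀ a n, c * q ^ n * p a ≤ p (a + n)) := by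
  -- If `p` is bounded below, its partial sums are unbounded and the endpoint `p 0` becomes
  -- negligible in `h 0 b`, so `p` dominates its partial sums. If not, the right endpoint can be
  -- sent along values tending to zero, so `p` dominates its tails.
  by_cases hinf : ∃ m > 0, ∀ n, m ≤ p n
  · right
    obtain ⟨m, hm, hmp⟩ := hinf
    set S : ℕ → ℝ := fun b => ∑ j ∈ Finset.range b, p j with hS
    have hSs : ∀ b, S (b + 1) = S b + p b := fun b => Finset.sum_range_succ _ _
    have hSmono : Monotone S := monotone_nat_of_le_succ fun b => by
      rw [hSs]
      linarith [hp b]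
    have hS0 : ∀ b, 0 ≤ S b := fun b => Finset.sum_nonneg fun j _ => (hp j).le
    have hSm : ∀ b : ℕ, m * b ≤ S b := fun b => by
      have := Finset.card_nsmul_le_sum (Finset.range b) p m fun j _ => hmp j
      simpa [mul_comm] using this
    obtain ⟨b0, hb0⟩ := exists_nat_gt (2 * p 0 / (ε * m))
    rw [div_lt_iff₀ (by positivity)] at hb0
    -- The first entry serves `b ≥ b0`, where `p 0` is at most half of `ε * S b`; the second serves
    -- the finitely many `b ≤ b0`.
    set δ := min (ε / 2) (m / (S b0 + 1)) with hδ
    have hδ0 : 0 < δ := lt_min (by positivity) (div_pos hm (by linarith [hS0 b0]))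
    have hpS : ∀ b, δ * S b ≤ p b := by
      intro b
      rcases le_total b b0 with hb | hb
      · have h1 : δ * (S b0 + 1) ≤ m := by
          rw [← le_div_iff₀ (by linarith [hS0 b0])]
          exact min_le_right _ _
        have h2 := mul_le_mul_of_nonneg_left (hSmono hb) hδ0.le
        linarith [hmp b]
      · rcases Nat.eq_zero_or_pos b with rfl | hbpos
        · simpa [hS] using (hp 0).le
        have h1 := h 0 b hbpos
        rw [← Finset.range_eq_Ico] at h1
        have h2 : (b0 : ℝ) ≤ b := by exact_mod_cast hb
        have h3 : 2 * p 0 ≤ ε * S b := by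
          have := mul_le_mul_of_nonneg_left (hSm b) hε.le
          have := mul_le_mul_of_nonneg_left h2 (show 0 ≤ ε * m by positivity)
          nlinarith
        have h4 : δ * S b ≤ ε / 2 * S b :=
          mul_le_mul_of_nonneg_right (min_le_left _ _) (hS0 b)
        change ε * S b ≤ _ at h1
        linarith
    have hgrow : ∀ b n, (1 + δ) ^ n * S b ≤ S (b + n) := by
      intro b n
      induction n with
      | zero => simp
      | succ n ih =>
        rw [← add_assoc, hSs, pow_succ]
        have h1 := mul_le_mul_of_nonneg_right ih (show 0 ≤ 1 + δ by positivity)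
        linarith [hpS (b + n)]
    refine ⟨1 + δ, min 1 (δ / (1 + δ)), by linarith, by positivity, fun a n => ?_⟩
    rcases n with _ | n
    · simpa using mul_le_of_le_one_left (hp a).le (min_le_left _ _)
    · have h1 : p a ≤ S (a + 1) := by
        rw [hSs]
        linarith [hS0 a]
      calc _ ≤ δ / (1 + δ) * (1 + δ) ^ (n + 1) * p a := by
            gcongr
            · exact (hp a).le
            · exact min_le_right _ _
        _ = δ * ((1 + δ) ^ n * p a) := by
            rw [pow_succ]
            field_simp
        _ ≤ δ * ((1 + δ) ^ n * S (a + 1)) := by gcongr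
        _ ≤ δ * S (a + 1 + n) := by gcongr; exact hgrow _ _
        _ ≤ p (a + 1 + n) := hpS _
        _ = p (a + (n + 1)) := by ring_nf
  · left
    push Not at hinf
    set η := min ε (1 / 2) with hη
    have hη0 : 0 < η := by positivity
    have hη1 : η ≤ 1 / 2 := min_le_right _ _
    have hsmall : ∀ a, ∀ δ > 0, ∀ d, ∃ c, d ≤ c ∧ a < c ∧ p c < δ := by
      intro a δ hδ d
      by_contra! hcon
      set e := max d (a + 1)
      -- A value below the positive minimum of an initial segment must occur beyond that segment.
      obtain ⟨i, -, hi⟩ := (Finset.range (e + 1)).exists_min_image p ⟨0, by simp⟩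
      obtain ⟨n, hn⟩ := hinf (min δ (p i)) (lt_min hδ (hp i))
      rcases lt_or_ge n (e + 1) with hne | hne
      · exact absurd (hi n (Finset.mem_range.2 hne)) (not_le.2 (hn.trans_le (min_le_right _ _)))
      · have h1 : d ≤ e := le_max_left _ _
        have h2 : a + 1 ≤ e := le_max_right _ _
        exact absurd (hcon n (by omega) (by omega)) (not_le.2 (hn.trans_le (min_le_left _ _)))
    have hsum : ∀ a d, η * ∑ j ∈ Finset.Ico a d, p j ≤ p a := by
      intro a d
      refine le_of_forall_pos_le_add fun δ hδ => ?_
      obtain ⟨c, hdc, hac, hc⟩ := hsmall a δ hδ d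
      have h1 := h a c hac
      have h2 : ∑ j ∈ Finset.Ico a d, p j ≤ ∑ j ∈ Finset.Ico a c, p j :=
        Finset.sum_le_sum_of_subset_of_nonneg (Finset.Ico_subset_Ico_right hdc)
          fun j _ _ => (hp j).le
      have h3 : 0 ≤ ∑ j ∈ Finset.Ico a c, p j := Finset.sum_nonneg fun j _ => (hp j).le
      have h4 := mul_le_mul_of_nonneg_left h2 hη0.le
      have h5 := mul_le_mul_of_nonneg_right (min_le_left ε (1 / 2)) h3
      linarith
    -- By `hsum`, dropping the first term of a tail sum removes at least the fraction `η` of it.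
    have hdec : ∀ a n d, a + n ≤ d →
        η * ∑ j ∈ Finset.Ico (a + n) d, p j ≤ (1 - η) ^ n * p a := by
      intro a n
      induction n with
      | zero =>
        intro d _
        simpa using hsum a d
      | succ n ih =>
        intro d hd
        have h1 := ih d (by omega)
        have h2 := hsum (a + n) d
        rw [Finset.sum_eq_sum_Ico_succ_bot (by omega)] at h1 h2
        rw [← add_assoc, pow_succ]
        nlinarith [hp (a + n)]
    refine ⟨1 - η, 1 / η, by linarith, by linarith, fun a n => ?_⟩
    have h1 := hdec a n (a + n + 1) (by omega)
    rw [Nat.Ico_succ_singleton, Finset.sum_singleton] at h1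
    rw [mul_assoc, one_div, ← div_eq_inv_mul, le_div_iff₀ hη0]
    linarith

/-! ### Vector-valued power series and the identity theorem -/

section Series

variable {X : Type*} [NormedAddCommGroup X] [NormedSpace ℂ X] [CompleteSpace X]

theorem summable_pow_smul {e : ℕ → X} {r K : ℝ} (hr : 0 < r) (he : ∀ n, ‖e n‖ ≤ K * (r ^ n)⁻¹)
    {z : ℂ} (hz : ‖z‖ < r) : Summable fun n : ℕ => z ^ n • e n := by
  refine Summable.of_norm_bounded (g := fun n => K * (‖z‖ / r) ^ n)
    ((summable_geometric_of_lt_one (by positivity) ((div_lt_one hr).2 hz)).mul_left K) fun n => ?_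
  rw [norm_smul, norm_pow, div_pow]
  calc _ ≤ ‖z‖ ^ n * (K * (r ^ n)⁻¹) := mul_le_mul_of_nonneg_left (he n) (by positivity)
    _ = _ := by ring

/-- A power series vanishing near a point of its disc of convergence vanishes identically. -/
theorem eq_zero_of_eventually_tsum_pow_smul_eq_zero {e : ℕ → X} {r K : ℝ}
    (he : ∀ n, ‖e n‖ ≤ K * (r ^ n)⁻¹) {z₀ : ℂ} (hz₀ : ‖z₀‖ < r)
    (h : ∀ᶠ z in 𝓝 z₀, ∑' n : ℕ, z ^ n • e n = 0) (n : ℕ) : e n = 0 := by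
  have hr : 0 < r := (norm_nonneg _).trans_lt hz₀
  obtain ⟨s, hs0, hs⟩ := exists_between hz₀
  have hs' : 0 < s := (norm_nonneg _).trans_lt hs0
  have hK : 0 ≤ K := by simpa using (norm_nonneg _).trans (he 0)
  set g : ℂ → X := fun z => ∑' n : ℕ, z ^ n • e n
  have hg : DifferentiableOn ℂ g (Metric.ball 0 s) := by
    refine Complex.differentiableOn_tsum_of_summable_norm (u := fun n => K * (s / r) ^ n)
      ((summable_geometric_of_lt_one (by positivity) ((div_lt_one hr).2 hs)).mul_left K)
      (fun n => ((differentiable_pow n).smul_const (e n)).differentiableOn) Metric.isOpen_ball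
      fun n z hz => ?_
    rw [mem_ball_zero_iff] at hz
    rw [norm_smul, norm_pow, div_pow]
    calc _ ≤ s ^ n * (K * (r ^ n)⁻¹) := mul_le_mul (pow_le_pow_left₀ (norm_nonneg _) hz.le n)
          (he n) (norm_nonneg _) (by positivity)
      _ = _ := by ring
  have hg0 : EqOn g 0 (Metric.ball 0 s) :=
    (hg.analyticOnNhd Metric.isOpen_ball).eqOn_zero_of_preconnected_of_eventuallyEq_zero
      (convex_ball _ _).isPreconnected (by simpa using hs0) h
  let p : FormalMultilinearSeries ℂ ℂ X := fun n => ContinuousMultilinearMap.mkPiRing ℂ (Fin n) (e n)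
  have hp : ∀ n, p.coeff n = e n := fun n => by simp [p, FormalMultilinearSeries.coeff]
  have hps : HasFPowerSeriesAt 0 p (0 : ℂ) := by
    rw [hasFPowerSeriesAt_iff']
    filter_upwards [Metric.ball_mem_nhds (0 : ℂ) hs'] with z hz
    simp only [sub_zero, hp]
    rw [← hg0 hz]
    exact (summable_pow_smul hr he ((mem_ball_zero_iff.1 hz).trans hs)).hasSum
  rw [← hp, hps.eq_zero]
  rfl

/-- A closed subspace containing the values of a power series near a point contains all its
coefficients. -/
theorem mem_of_eventually_tsum_pow_smul_mem {e : ℕ → X} {r K : ℝ}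
    (he : ∀ n, ‖e n‖ ≤ K * (r ^ n)⁻¹) {z₀ : ℂ} (hz₀ : ‖z₀‖ < r) {M : Submodule ℂ X}
    (hM : IsClosed (M : Set X)) (h : ∀ᶠ z in 𝓝 z₀, ∑' n : ℕ, z ^ n • e n ∈ M) (n : ℕ) :
    e n ∈ M := by
  -- In the quotient by `M` the series vanishes near `z₀`, so the identity theorem kills all its
  -- coefficients.
  rw [← Submodule.Quotient.mk_eq_zero]
  refine eq_zero_of_eventually_tsum_pow_smul_eq_zero (e := fun n => (Submodule.Quotient.mk (e n)))
    (fun n => (Submodule.Quotient.norm_mk_le M (e n)).trans (he n)) hz₀ ?_ n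
  filter_upwards [h, Metric.isOpen_ball.mem_nhds (mem_ball_zero_iff.2 hz₀)] with z hz hzr
  have h1 := M.mkQL.hasSum (summable_pow_smul ((norm_nonneg _).trans_lt hz₀) he
    (mem_ball_zero_iff.1 hzr)).hasSum
  refine Eq.trans ?_ ((Submodule.Quotient.mk_eq_zero M).2 hz)
  exact h1.tsum_eq

end Series

/-! ### Operators induced on quotient spaces -/

section Quotient

variable {X Y : Type*} [NormedAddCommGroup X] [NormedSpace ℂ X] [NormedAddCommGroup Y]
  [NormedSpace ℂ Y]

/-- `q` is a quotient map of normed spaces: the norm of `Y` is the quotient norm. -/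
structure IsNormQuotient (q : X →L[ℂ] Y) : Prop where
  norm_apply_le : ∀ x, ‖q x‖ ≤ ‖x‖
  exists_lift : ∀ y, ∀ ε > 0, ∃ x, q x = y ∧ ‖x‖ < ‖y‖ + ε

variable {q : X →L[ℂ] Y}

theorem IsNormQuotient.surjective (hq : IsNormQuotient q) : Function.Surjective q := fun y => by
  obtain ⟨x, hx, -⟩ := hq.exists_lift y 1 one_pos
  exact ⟨x, hx⟩

theorem IsNormQuotient.norm_apply_le_of_semiconj (hq : IsNormQuotient q) {S : X →L[ℂ] X}
    {t : Y → Y} (h : ∀ x, q (S x) = t (q x)) (y : Y) : ‖t y‖ ≤ ‖S‖ * ‖y‖ := by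
  refine le_of_forall_pos_le_add fun ε hε => ?_
  obtain ⟨x, rfl, hx⟩ := hq.exists_lift y (ε / (‖S‖ + 1)) (by positivity)
  have h2 : ‖S‖ * (ε / (‖S‖ + 1)) ≤ ε := by
    rw [mul_div_assoc', div_le_iff₀ (by positivity)]
    nlinarith [norm_nonneg S]
  calc ‖t (q x)‖ = ‖q (S x)‖ := by rw [h]
    _ ≤ ‖S x‖ := hq.norm_apply_le _
    _ ≤ ‖S‖ * ‖x‖ := S.le_opNorm x
    _ ≤ ‖S‖ * (‖q x‖ + ε / (‖S‖ + 1)) := by gcongr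
    _ ≤ _ := by linarith

/-- Operators leaving the kernel invariant descend to a quotient. -/
theorem IsNormQuotient.exists_semiconj (hq : IsNormQuotient q) {S : X →L[ℂ] X}
    (hS : ∀ x, q x = 0 → q (S x) = 0) : ∃ t : Y →L[ℂ] Y, ∀ x, q (S x) = t (q x) := by
  choose g hg using hq.surjective
  have hwd : ∀ x x', q x = q x' → q (S x) = q (S x') := fun x x' hx => by
    rw [← sub_eq_zero, ← map_sub, ← map_sub]
    exact hS _ (by rw [map_sub, hx, sub_self])
  have ht : ∀ x, q (S x) = q (S (g (q x))) := fun x => hwd _ _ (hg _).symm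
  refine ⟨LinearMap.mkContinuous
    { toFun := fun y => q (S (g y))
      map_add' := fun y y' => ?_
      map_smul' := fun c y => ?_ } ‖S‖ (hq.norm_apply_le_of_semiconj ht), ht⟩
  · rw [← map_add, ← map_add]
    exact hwd _ _ (by rw [map_add, hg, hg, hg])
  · rw [RingHom.id_apply, ← map_smul, ← map_smul]
    exact hwd _ _ (by rw [map_smul, hg, hg])

theorem IsNormQuotient.norm_pow_le (hq : IsNormQuotient q) {S : X →L[ℂ] X} {t : Y →L[ℂ] Y}
    (h : ∀ x, q (S x) = t (q x)) (n : ℕ) : ‖t ^ n‖ ≤ ‖S ^ n‖ :=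
  (t ^ n).opNorm_le_bound (norm_nonneg _)
    (hq.norm_apply_le_of_semiconj (S := S ^ n) (t := ⇑(t ^ n)) fun x =>
      apply_pow_eq_of_semiconj h n x)

variable [CompleteSpace Y]

theorem IsNormQuotient.norm_le_of_mem_spectrum (hq : IsNormQuotient q) {S : X →L[ℂ] X}
    {t : Y →L[ℂ] Y} (h : ∀ x, q (S x) = t (q x)) {C r : ℝ} (hr : 0 < r)
    (hS : ∀ n, ‖S ^ n‖ ≤ C * r ^ n) {z : ℂ} (hz : z ∈ spectrum ℂ t) : ‖z‖ ≤ r :=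
  norm_le_of_mem_spectrum_of_eventually hr
    (Eventually.of_forall fun n => (hq.norm_pow_le h n).trans (hS n)) hz

/-- `S` need only invert `B` modulo the kernel of `q`: it then induces the inverse of `t`, and the
bound on its powers confines the spectrum of that inverse to the disc of radius `r⁻¹`. -/
theorem IsNormQuotient.le_norm_of_mem_spectrum (hq : IsNormQuotient q) {S B : X →L[ℂ] X}
    {t : Y →L[ℂ] Y} (hB : ∀ x, q (B x) = t (q x)) (hS : ∀ x, q x = 0 → q (S x) = 0)
    (hBS : ∀ x, q (B (S x)) = q x) (hSB : ∀ x, q (S (B x)) = q x) {C r : ℝ} (hr : 0 < r)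
    (hSn : ∀ n, ‖S ^ n‖ ≤ C * r⁻¹ ^ n) {z : ℂ} (hz : z ∈ spectrum ℂ t) : r ≤ ‖z‖ := by
  obtain ⟨s, hs⟩ := hq.exists_semiconj hS
  have hts : t * s = 1 := by
    ext y
    obtain ⟨x, rfl⟩ := hq.surjective y
    rw [mul_apply_eq_comp, ← hs, ← hB, hBS, one_apply_eq_self]
  have hst : s * t = 1 := by
    ext y
    obtain ⟨x, rfl⟩ := hq.surjective y
    rw [mul_apply_eq_comp, ← hB, ← hs, hSB, one_apply_eq_self]
  let u : (Y →L[ℂ] Y)ˣ := ⟨t, s, hts, hst⟩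
  rcases eq_or_ne z 0 with rfl | hz0
  · exact absurd u.isUnit ((spectrum.zero_mem_iff ℂ).1 hz)
  have h1 : z⁻¹ ∈ spectrum ℂ s := by
    have := spectrum.map_inv (𝕜 := ℂ) u
    change _ = spectrum ℂ s at this
    rw [← this, Set.mem_inv, inv_inv]
    exact hz
  have h2 := hq.norm_le_of_mem_spectrum hs (inv_pos.2 hr) hSn h1
  rwa [norm_inv, inv_le_inv₀ (norm_pos_iff.2 hz0) hr] at h2

end Quotient

/-! ### Weight products, adjoint eigenvalues and eigenvectors of the shift -/

section Weights

variable {w : ℕ → ℝ} {hpos : ∀ n, 0 < w n} {hbdd : BddAbove (range w)}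

/-- The product of the first `n` weights. -/
noncomputable def weightProd (w : ℕ → ℝ) (n : ℕ) : ℝ := ∏ j ∈ Finset.range n, w j

theorem weightProd_succ (w : ℕ → ℝ) (n : ℕ) : weightProd w (n + 1) = weightProd w n * w n :=
  Finset.prod_range_succ _ _

theorem weightProd_pos (hpos : ∀ n, 0 < w n) (n : ℕ) : 0 < weightProd w n :=
  Finset.prod_pos fun j _ => hpos j

/-- Products of consecutive weights grow faster than `ρ ^ n`. -/
def WeightsGrow (w : ℕ → ℝ) (ρ : ℝ) : Prop :=
  ∃ r c, ρ < r ∧ 0 < c ∧ ∀ a n, c * r ^ n * weightProd w a ≤ weightProd w (a + n)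

/-- Products of consecutive weights grow more slowly than `ρ ^ n`. -/
def WeightsDecay (w : ℕ → ℝ) (ρ : ℝ) : Prop :=
  ∃ r C, 0 < r ∧ r < ρ ∧ ∀ a n, weightProd w (a + n) ≤ C * r ^ n * weightProd w a

/-- Pair with `g j = W j / lam ^ j` on a window `[a, b)`. On the range of `B - lam` the sum
telescopes to boundary terms at `a` and `b`, which are negligible against `∑ ‖g j‖`. The unimodular
`v` is aligned with `g`, so its pairing is the full `∑ ‖g j‖`; hence `v` is at distance at least `1`
from the range. -/
theorem one_le_norm_sub_of_windows {lam : ℂ} (hlam : 0 < ‖lam‖)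
    (h : ∀ ε > 0, ∃ a b, a < b ∧ weightProd w a / ‖lam‖ ^ a + weightProd w b / ‖lam‖ ^ b <
      ε * ∑ j ∈ Finset.Ico a b, weightProd w j / ‖lam‖ ^ j) :
    ∃ v : LInfty, ∀ y, 1 ≤ ‖v - (weightedBackwardShift w hpos hbdd - lam • 1) y‖ := by
  have hlam0 : lam ≠ 0 := norm_pos_iff.1 hlam
  have hunit : ∀ j, ‖(lam / ‖lam‖) ^ j‖ = 1 := fun j => by
    rw [norm_pow, norm_div, Complex.norm_real, norm_norm, div_self hlam.ne', one_pow]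
  let v : LInfty := ⟨fun j => (lam / ‖lam‖) ^ j, memℓp_infty ⟨1, by
    rintro _ ⟨j, rfl⟩
    exact (hunit j).le⟩⟩
  refine ⟨v, fun y => ?_⟩
  by_contra! hlt
  set z := v - (weightedBackwardShift w hpos hbdd - lam • 1) y with hz
  have hzj : ∀ j, z j = (lam / ‖lam‖) ^ j - ((w j : ℂ) * y (j + 1) - lam * y j) := fun j => rfl
  set g : ℕ → ℂ := fun j => (weightProd w j : ℂ) / lam ^ j with hg
  have hgw : ∀ j, g j * w j = lam * g (j + 1) := fun j => by
    simp only [hg, weightProd_succ, Complex.ofReal_mul, pow_succ]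
    field_simp
  have hgn : ∀ j, ‖g j‖ = weightProd w j / ‖lam‖ ^ j := fun j => by
    rw [norm_div, norm_pow, Complex.norm_real, Real.norm_of_nonneg (weightProd_pos hpos j).le]
  have hgv : ∀ j, g j * (lam / ‖lam‖) ^ j = (‖g j‖ : ℂ) := fun j => by
    rw [hgn]
    have : (‖lam‖ : ℂ) ≠ 0 := by exact_mod_cast hlam.ne'
    simp only [hg, div_pow]
    push_cast
    field_simp
  have htel : ∀ a b, a ≤ b → ∑ j ∈ Finset.Ico a b, g j * z j =
      (∑ j ∈ Finset.Ico a b, ‖g j‖ : ℝ) - lam * (g b * y b - g a * y a) := by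
    intro a b hab
    induction b, hab using Nat.le_induction with
    | base => simp
    | succ b hab ih =>
      rw [Finset.sum_Ico_succ_top hab, Finset.sum_Ico_succ_top hab, ih, hzj]
      push_cast
      have h1 := hgw b
      have h2 := hgv b
      linear_combination h2 - y (b + 1) * h1
  -- This `ε` makes the boundary terms, of size `‖lam‖ * ‖y‖ * (‖g a‖ + ‖g b‖)`, smaller than the
  -- deficit `(1 - ‖z‖) * σ`.
  obtain ⟨a, b, hab, hlt'⟩ := h ((1 - ‖z‖) / (‖lam‖ * ‖y‖ + 1))
    (div_pos (by linarith) (by positivity))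
  simp only [← hgn] at hlt'
  set σ := ∑ j ∈ Finset.Ico a b, ‖g j‖ with hσ
  have hσ0 : 0 ≤ σ := Finset.sum_nonneg fun _ _ => norm_nonneg _
  have hup : ‖∑ j ∈ Finset.Ico a b, g j * z j‖ ≤ σ * ‖z‖ := by
    rw [hσ, Finset.sum_mul]
    refine norm_sum_le_of_le _ fun j _ => ?_
    rw [norm_mul]
    exact mul_le_mul_of_nonneg_left (lp.norm_apply_le_norm ENNReal.top_ne_zero z j) (norm_nonneg _)
  have hy : ∀ j, ‖g j * y j‖ ≤ ‖g j‖ * ‖y‖ := fun j => by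
    rw [norm_mul]
    exact mul_le_mul_of_nonneg_left (lp.norm_apply_le_norm ENNReal.top_ne_zero y j) (norm_nonneg _)
  have hlow : σ - ‖lam‖ * ((‖g a‖ + ‖g b‖) * ‖y‖) ≤ ‖∑ j ∈ Finset.Ico a b, g j * z j‖ := by
    rw [htel a b hab.le]
    have h1 := norm_sub_norm_le (σ : ℂ) (lam * (g b * y b - g a * y a))
    rw [norm_mul, Complex.norm_real, Real.norm_of_nonneg hσ0] at h1
    have h2 : ‖g b * y b - g a * y a‖ ≤ (‖g a‖ + ‖g b‖) * ‖y‖ :=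
      (norm_sub_le _ _).trans (by linarith [hy a, hy b])
    have h3 := mul_le_mul_of_nonneg_left h2 hlam.le
    linarith
  have hprod : (‖lam‖ * ‖y‖ + 1) * (‖g a‖ + ‖g b‖) < (1 - ‖z‖) * σ := by
    rw [div_mul_eq_mul_div, lt_div_iff₀ (by positivity)] at hlt'
    linarith
  nlinarith [norm_nonneg (g a), norm_nonneg (g b)]

/-- The case `lam = 0`, where dividing by powers of `lam` is impossible: at a coordinate with a tiny
weight every image of the shift is nearly `0`, so the constant sequence `1` cannot be approximated.
-/
theorem one_le_norm_sub_of_small_weights (h : ∀ ε > 0, ∃ n, w n < ε) :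
    ∃ v : LInfty, ∀ y, 1 ≤ ‖v - weightedBackwardShift w hpos hbdd y‖ := by
  refine ⟨1, fun y => ?_⟩
  by_contra! hlt
  set z := 1 - weightedBackwardShift w hpos hbdd y
  obtain ⟨n, hn⟩ := h ((1 - ‖z‖) / (‖y‖ + 1)) (div_pos (by linarith) (by positivity))
  rw [lt_div_iff₀ (by positivity)] at hn
  have h1 : (1 : ℂ) = z n + w n * y (n + 1) := by
    have : z n = 1 - w n * y (n + 1) := rfl
    rw [this]
    ring
  have h2 := norm_add_le (z n) (w n * y (n + 1))
  rw [← h1, norm_one, norm_mul, Complex.norm_real, Real.norm_of_nonneg (hpos n).le] at h2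
  have h3 := lp.norm_apply_le_norm ENNReal.top_ne_zero z n
  have h4 := mul_le_mul_of_nonneg_left (lp.norm_apply_le_norm ENNReal.top_ne_zero y (n + 1))
    (hpos n).le
  nlinarith [hpos n]

/-- For each `lam`, either products of consecutive weights grow faster or more slowly than
`‖lam‖ ^ n`, or the adjoint of the shift has `lam` as an eigenvalue. -/
theorem weights_trichotomy (hpos : ∀ n, 0 < w n) (hbdd : BddAbove (range w)) (lam : ℂ) :
    WeightsGrow w ‖lam‖ ∨ WeightsDecay w ‖lam‖ ∨ ∃ (φ : LInfty →L[ℂ] ℂ) (v : LInfty), φ v ≠ 0 ∧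
      ∀ y, φ (weightedBackwardShift w hpos hbdd y) = lam * φ y := by
  have key : (∃ v : LInfty,
      ∀ y, 1 ≤ ‖v - (weightedBackwardShift w hpos hbdd - lam • 1) y‖) →
      ∃ (φ : LInfty →L[ℂ] ℂ) (v : LInfty), φ v ≠ 0 ∧
        ∀ y, φ (weightedBackwardShift w hpos hbdd y) = lam * φ y := by
    rintro ⟨v, hv⟩
    obtain ⟨φ, hφv, hφ⟩ := exists_functional_of_norm_sub_ge one_pos hv
    refine ⟨φ, v, hφv, fun y => sub_eq_zero.1 ?_⟩
    rw [← hφ y, sub_apply, map_sub, smul_apply, map_smul, smul_eq_mul]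
    rfl
  rcases eq_or_ne lam 0 with rfl | hlam
  · by_cases hw : ∀ ε > 0, ∃ n, w n < ε
    · exact Or.inr (Or.inr (key (by simpa using one_le_norm_sub_of_small_weights hw)))
    · push Not at hw
      obtain ⟨δ, hδ, hδw⟩ := hw
      refine Or.inl ⟨δ, 1, by simpa using hδ, one_pos, fun a n => ?_⟩
      induction n with
      | zero => simp
      | succ n ih =>
        rw [← add_assoc, weightProd_succ, pow_succ]
        have := mul_le_mul ih (hδw (a + n)) hδ.le (weightProd_pos hpos _).le
        linarith
  have hl : 0 < ‖lam‖ := norm_pos_iff.2 hlam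
  by_cases hwin : ∀ ε > 0, ∃ a b, a < b ∧ weightProd w a / ‖lam‖ ^ a + weightProd w b / ‖lam‖ ^ b <
      ε * ∑ j ∈ Finset.Ico a b, weightProd w j / ‖lam‖ ^ j
  · exact Or.inr (Or.inr (key (one_le_norm_sub_of_windows hl hwin)))
  push Not at hwin
  obtain ⟨ε, hε, hwin⟩ := hwin
  -- Without windows of small relative boundary, the normalised products `W n / ‖lam‖ ^ n` satisfy
  -- the dichotomy; undoing the normalisation turns the ratio `q` into `q * ‖lam‖`.
  rcases exponential_dichotomy (fun n => div_pos (weightProd_pos hpos n) (pow_pos hl n)) hε hwin with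
    ⟨q, C, hq0, hq1, h⟩ | ⟨q, c, hq1, hc, h⟩
  · refine Or.inr (Or.inl ⟨q * ‖lam‖, C, by positivity, by nlinarith, fun a n => ?_⟩)
    have h1 := h a n
    rw [div_le_iff₀ (by positivity)] at h1
    refine h1.trans (le_of_eq ?_)
    rw [mul_pow, pow_add]
    field_simp
  · refine Or.inl ⟨q * ‖lam‖, c, by nlinarith, hc, fun a n => ?_⟩
    have h1 := h a n
    rw [le_div_iff₀ (by positivity)] at h1
    refine (le_of_eq ?_).trans h1
    rw [mul_pow, pow_add]
    field_simp

/-- Multiplication of coordinates by `W` conjugates `B` to the unweighted shift, so norms of powers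
are read off from ratios of weight products. -/
theorem weightProd_mul_pow_apply (n : ℕ) (x : LInfty) (k : ℕ) :
    (weightProd w k : ℂ) * (weightedBackwardShift w hpos hbdd ^ n) x k =
      weightProd w (k + n) * x (k + n) := by
  rw [weightedBackwardShift_pow_apply, ← mul_assoc, ← Complex.ofReal_mul, weightProd,
    Finset.prod_range_mul_prod_Ico w (Nat.le_add_right k n), weightProd]

theorem WeightsDecay.exists_norm_pow_le {ρ : ℝ} (h : WeightsDecay w ρ) :
    ∃ r C, 0 < r ∧ r < ρ ∧ ∀ n, ‖weightedBackwardShift w hpos hbdd ^ n‖ ≤ C * r ^ n := by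
  obtain ⟨r, C, hr, hrρ, h⟩ := h
  have hC : 0 ≤ C := by
    have := h 0 0
    simp only [add_zero, pow_zero, mul_one] at this
    nlinarith [weightProd_pos hpos 0]
  refine ⟨r, C, hr, hrρ, fun n => ContinuousLinearMap.opNorm_le_bound _ (by positivity) fun x =>
    lp.norm_le_of_forall_le (by positivity) fun k => ?_⟩
  have h1 := congrArg norm (weightProd_mul_pow_apply (hpos := hpos) (hbdd := hbdd) n x k)
  rw [norm_mul, norm_mul, Complex.norm_real, Complex.norm_real,
    Real.norm_of_nonneg (weightProd_pos hpos _).le,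
    Real.norm_of_nonneg (weightProd_pos hpos _).le] at h1
  refine le_of_mul_le_mul_left ?_ (weightProd_pos hpos k)
  rw [h1]
  calc _ ≤ C * r ^ n * weightProd w k * ‖x‖ := mul_le_mul (h k n)
        (lp.norm_apply_le_norm ENNReal.top_ne_zero x _) (norm_nonneg _)
        ((weightProd_pos hpos _).le.trans (h k n))
    _ = _ := by ring

/-- The coefficients of the eigenvector series of the shift. -/
noncomputable def eigenCoeff (w : ℕ → ℝ) (n : ℕ) : LInfty :=
  ((weightProd w n : ℂ)⁻¹) • lp.single ∞ n (1 : ℂ)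

theorem norm_eigenCoeff (hpos : ∀ n, 0 < w n) (n : ℕ) : ‖eigenCoeff w n‖ = (weightProd w n)⁻¹ := by
  rw [eigenCoeff, norm_smul, norm_inv, Complex.norm_real,
    Real.norm_of_nonneg (weightProd_pos hpos n).le, lp.norm_single (p := ∞) (by simp), norm_one,
    mul_one]

theorem weightedBackwardShift_eigenCoeff_zero :
    weightedBackwardShift w hpos hbdd (eigenCoeff w 0) = 0 := by
  ext k
  rw [weightedBackwardShift_apply, eigenCoeff, lp.coeFn_smul, Pi.smul_apply, lp.single_apply_ne]
  · simp
  · omega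

theorem weightedBackwardShift_eigenCoeff_succ (n : ℕ) :
    weightedBackwardShift w hpos hbdd (eigenCoeff w (n + 1)) = eigenCoeff w n := by
  ext k
  rw [weightedBackwardShift_apply, eigenCoeff, eigenCoeff, lp.coeFn_smul, lp.coeFn_smul,
    Pi.smul_apply, Pi.smul_apply]
  rcases eq_or_ne k n with rfl | hk
  · rw [lp.single_apply_self, lp.single_apply_self, weightProd_succ]
    have h1 : (w k : ℂ) ≠ 0 := by exact_mod_cast (hpos k).ne'
    push_cast
    rw [smul_eq_mul, smul_eq_mul, mul_one, mul_one, mul_inv, mul_comm, mul_assoc,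
      inv_mul_cancel₀ h1, mul_one]
  · rw [lp.single_apply_ne _ _ _ (by omega), lp.single_apply_ne _ _ _ hk]
    simp

/-- The eigenvector of the shift with eigenvalue `z`. -/
noncomputable def eigenVector (w : ℕ → ℝ) (z : ℂ) : LInfty := ∑' n : ℕ, z ^ n • eigenCoeff w n

theorem norm_eigenCoeff_le (hpos : ∀ n, 0 < w n) {r c : ℝ} (hr : 0 < r) (hc : 0 < c)
    (h : ∀ a n, c * r ^ n * weightProd w a ≤ weightProd w (a + n)) (n : ℕ) :
    ‖eigenCoeff w n‖ ≤ c⁻¹ * (r ^ n)⁻¹ := by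
  rw [norm_eigenCoeff hpos, ← mul_inv]
  refine inv_anti₀ (by positivity) ?_
  simpa [weightProd] using h 0 n

theorem weightedBackwardShift_eigenVector {z : ℂ} (hs : Summable fun n => z ^ n • eigenCoeff w n) :
    weightedBackwardShift w hpos hbdd (eigenVector w z) = z • eigenVector w z := by
  have h1 := (weightedBackwardShift w hpos hbdd).hasSum hs.hasSum
  have h2 := (hasSum_nat_add_iff' 1).2 h1
  simp only [Finset.sum_range_one, map_smul, weightedBackwardShift_eigenCoeff_zero,
    weightedBackwardShift_eigenCoeff_succ, smul_zero, sub_zero] at h2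
  refine h2.unique ?_
  convert! hs.hasSum.const_smul z using 2 with n
  rw [smul_smul, pow_succ']

theorem eigenVector_ne_zero {z : ℂ} (hs : Summable fun n => z ^ n • eigenCoeff w n) :
    eigenVector w z ≠ 0 := by
  intro h0
  have h1 := (lp.evalCLM ℂ (fun _ : ℕ => ℂ) ∞ 0).hasSum hs.hasSum
  have h2 : HasSum (fun n => (z ^ n • eigenCoeff w n : LInfty) 0) ((eigenVector w z) 0) := h1
  have h3 : HasSum (fun n => (z ^ n • eigenCoeff w n : LInfty) 0)
      ((z ^ 0 • eigenCoeff w 0 : LInfty) 0) := by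
    refine hasSum_single 0 fun n hn => ?_
    rw [eigenCoeff, lp.coeFn_smul, Pi.smul_apply, lp.coeFn_smul, Pi.smul_apply,
      lp.single_apply_ne _ _ _ hn.symm]
    simp
  have h4 := h2.unique h3
  rw [h0, eigenCoeff, lp.coeFn_smul, Pi.smul_apply, lp.coeFn_smul, Pi.smul_apply,
    lp.single_apply_self] at h4
  simp [weightProd] at h4

/-- The eigenvector series converges on the disc of the growth rate, which strictly exceeds `ρ`.
This excludes growth at boundary points of the spectrum. -/
theorem WeightsGrow.mem_spectrum {ρ : ℝ} (hρ : 0 ≤ ρ) (h : WeightsGrow w ρ) :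
    ∃ r > ρ, ∀ z : ℂ, ‖z‖ < r → z ∈ spectrum ℂ (weightedBackwardShift w hpos hbdd) := by
  obtain ⟨r, c, hr, hc, h⟩ := h
  have hr0 : 0 < r := hρ.trans_lt hr
  refine ⟨r, hr, fun z hz hu => ?_⟩
  have hs := summable_pow_smul hr0 (norm_eigenCoeff_le hpos hr0 hc h) hz
  obtain ⟨A, hA⟩ := (show IsUnit _ from hu).exists_left_inv
  have h1 := DFunLike.congr_fun hA (eigenVector w z)
  have h2 : (algebraMap ℂ (LInfty →L[ℂ] LInfty) z - weightedBackwardShift w hpos hbdd)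
      (eigenVector w z) = 0 := by
    rw [sub_apply, weightedBackwardShift_eigenVector hs, Algebra.algebraMap_eq_smul_one]
    exact sub_self _
  rw [mul_apply_eq_comp, h2, map_zero] at h1
  exact eigenVector_ne_zero hs h1.symm

end Weights

/-! ### The subspace `c_0` and the quotient `l^∞ / c_0` -/

/-- The closed subspace `c_0` of `l^∞`. -/
def cZeroSubmodule : Submodule ℂ LInfty where
  carrier := cZero
  add_mem' {x y} hx hy := by
    have h : Tendsto (fun n => x n + y n) atTop (𝓝 (0 + 0)) := Tendsto.add hx hy
    rwa [add_zero] at h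
  zero_mem' := tendsto_const_nhds
  smul_mem' c x hx := by
    have h : Tendsto (fun n => c * x n) atTop (𝓝 (c * 0)) := Tendsto.const_mul c hx
    rwa [mul_zero] at h

theorem mem_cZeroSubmodule {x : LInfty} :
    x ∈ cZeroSubmodule ↔ Tendsto (fun n => x n) atTop (𝓝 0) := Iff.rfl

instance isClosed_cZeroSubmodule : IsClosed (cZeroSubmodule : Set LInfty) := by
  refine isClosed_of_closure_subset fun x hx => ?_
  refine Metric.tendsto_atTop.2 fun ε hε => ?_
  obtain ⟨y, hy, hxy⟩ := Metric.mem_closure_iff.1 hx (ε / 2) (by positivity)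
  obtain ⟨N, hN⟩ := Metric.tendsto_atTop.1 hy (ε / 2) (by positivity)
  refine ⟨N, fun n hn => ?_⟩
  have h1 := hN n hn
  have h2 := lp.norm_apply_le_norm ENNReal.top_ne_zero (x - y) n
  rw [dist_eq_norm] at hxy h1 ⊢
  rw [sub_zero] at h1 ⊢
  have h3 : x n = (x - y) n + y n := (sub_add_cancel (x n) (y n)).symm
  calc ‖x n‖ ≤ ‖(x - y) n‖ + ‖y n‖ := by rw [h3]; exact norm_add_le _ _
    _ < ε := by linarith

/-- The Banach space `l^∞ / c_0`. -/
def ModCZero : Type := LInfty ⧸ cZeroSubmodule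

noncomputable instance : NormedAddCommGroup ModCZero :=
  inferInstanceAs (NormedAddCommGroup (LInfty ⧸ cZeroSubmodule))

noncomputable instance : NormedSpace ℂ ModCZero :=
  inferInstanceAs (NormedSpace ℂ (LInfty ⧸ cZeroSubmodule))

instance : CompleteSpace ModCZero :=
  inferInstanceAs (CompleteSpace (LInfty ⧸ cZeroSubmodule))

/-- The quotient map from `l^∞` to `l^∞ / c_0`. -/
noncomputable def modCZero : LInfty →L[ℂ] ModCZero :=
  LinearMap.mkContinuous
    { toFun := fun x => (Submodule.Quotient.mk x : LInfty ⧸ cZeroSubmodule)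
      map_add' := fun _ _ => rfl
      map_smul' := fun _ _ => rfl }
    1 fun x => (Submodule.Quotient.norm_mk_le cZeroSubmodule x).trans (one_mul _).ge

theorem modCZero_eq_zero_iff {x : LInfty} : modCZero x = 0 ↔ x ∈ cZeroSubmodule :=
  Submodule.Quotient.mk_eq_zero cZeroSubmodule

theorem isNormQuotient_modCZero : IsNormQuotient modCZero where
  norm_apply_le x := Submodule.Quotient.norm_mk_le cZeroSubmodule x
  exists_lift y _ hε := Submodule.Quotient.norm_mk_lt (S := cZeroSubmodule) y hε

/-- A closed subspace containing the unit vectors contains `c_0`. -/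
theorem cZero_subset_of_single_mem {M : Submodule ℂ LInfty} (hM : IsClosed (M : Set LInfty))
    (h : ∀ n, lp.single ∞ n (1 : ℂ) ∈ M) : cZero ⊆ M := by
  intro x hx
  let s : ℕ → LInfty := fun N => ∑ n ∈ Finset.range N, x n • lp.single ∞ n (1 : ℂ)
  have hs : ∀ N k, s N k = if k < N then x k else 0 := by
    intro N k
    induction N with
    | zero => simp [s]
    | succ N ih =>
      have h1 : s (N + 1) = s N + x N • lp.single ∞ N (1 : ℂ) := Finset.sum_range_succ _ _
      rw [h1, lp.coeFn_add, Pi.add_apply, ih, lp.coeFn_smul, Pi.smul_apply]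
      rcases lt_trichotomy k N with hk | rfl | hk
      · rw [lp.single_apply_ne _ _ _ hk.ne, if_pos hk, if_pos (by omega), smul_zero, add_zero]
      · rw [lp.single_apply_self, if_neg (lt_irrefl _), if_pos (Nat.lt_succ_self _), zero_add,
          smul_eq_mul, mul_one]
      · rw [lp.single_apply_ne _ _ _ hk.ne', if_neg (by omega), if_neg (by omega), smul_zero,
          add_zero]
  refine hM.mem_of_tendsto (f := s) (b := atTop) ?_ (Eventually.of_forall fun N =>
    Submodule.sum_mem _ fun n _ => M.smul_mem _ (h n))
  refine Metric.tendsto_atTop.2 fun ε hε => ?_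
  obtain ⟨N, hN⟩ := Metric.tendsto_atTop.1 hx (ε / 2) (by positivity)
  refine ⟨N, fun n hn => ?_⟩
  rw [dist_eq_norm]
  refine lt_of_le_of_lt (lp.norm_le_of_forall_le (half_pos hε).le fun k => ?_) (half_lt_self hε)
  rw [lp.coeFn_sub, Pi.sub_apply, hs]
  split_ifs with hk
  · simpa using (half_pos hε).le
  · have := hN k (by omega)
    rw [dist_eq_norm, sub_zero] at this
    rw [zero_sub, norm_neg]
    exact this.le

/-! ### The forward shift and the spectrum on `l^∞ / c_0` -/

section ForwardShift

variable {w : ℕ → ℝ} {hpos : ∀ n, 0 < w n} {hbdd : BddAbove (range w)}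

/-- The coordinates of the weighted forward shift inverting the backward shift. -/
noncomputable def forwardShiftFun (w : ℕ → ℝ) (x : ℕ → ℂ) : ℕ → ℂ
  | 0 => 0
  | n + 1 => (w n : ℂ)⁻¹ * x n

theorem norm_forwardShiftFun_le {δ : ℝ} (hδ : 0 < δ) (hw : ∀ n, δ ≤ w n) (x : LInfty) (n : ℕ) :
    ‖forwardShiftFun w x n‖ ≤ δ⁻¹ * ‖x‖ := by
  cases n with
  | zero =>
    rw [forwardShiftFun, norm_zero]
    positivity
  | succ n =>
    rw [forwardShiftFun, norm_mul, norm_inv, Complex.norm_real,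
      Real.norm_of_nonneg (hδ.le.trans (hw n))]
    exact mul_le_mul (inv_anti₀ hδ (hw n)) (lp.norm_apply_le_norm ENNReal.top_ne_zero x n)
      (norm_nonneg _) (by positivity)

/-- The weighted forward shift inverting the backward shift, for weights bounded below. -/
noncomputable def forwardShift (w : ℕ → ℝ) {δ : ℝ} (hδ : 0 < δ) (hw : ∀ n, δ ≤ w n) :
    LInfty →L[ℂ] LInfty :=
  LinearMap.mkContinuous
    { toFun := fun x => ⟨forwardShiftFun w x, memℓp_infty ⟨δ⁻¹ * ‖x‖, by
        rintro _ ⟨n, rfl⟩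
        exact norm_forwardShiftFun_le hδ hw x n⟩⟩
      map_add' := fun x y => by
        ext n
        cases n with
        | zero => exact (add_zero _).symm
        | succ n => exact mul_add _ _ _
      map_smul' := fun c x => by
        ext n
        cases n with
        | zero => exact (mul_zero _).symm
        | succ n => exact mul_left_comm _ _ _ }
    δ⁻¹ fun x => lp.norm_le_of_forall_le (by positivity) (norm_forwardShiftFun_le hδ hw x)

variable {δ : ℝ} (hδ : 0 < δ) (hw : ∀ n, δ ≤ w n)

theorem forwardShift_apply_succ (x : LInfty) (n : ℕ) :
    forwardShift w hδ hw x (n + 1) = (w n : ℂ)⁻¹ * x n := rfl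

include hpos in
theorem norm_forwardShift_pow_le {r c : ℝ} (hr : 0 < r) (hc : 0 < c)
    (h : ∀ a n, c * r ^ n * weightProd w a ≤ weightProd w (a + n)) (n : ℕ) :
    ‖forwardShift w hδ hw ^ n‖ ≤ c⁻¹ * r⁻¹ ^ n := by
  have h1 : ∀ (n : ℕ) (x : LInfty), (∀ k < n, (forwardShift w hδ hw ^ n) x k = 0) ∧
      ∀ k, (weightProd w (k + n) : ℂ) * (forwardShift w hδ hw ^ n) x (k + n) =
        weightProd w k * x k := by
    intro n x
    induction n with
    | zero => simp
    | succ n ih =>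
      obtain ⟨ih1, ih2⟩ := ih
      rw [pow_succ', mul_apply_eq_comp]
      refine ⟨fun k hk => ?_, fun k => ?_⟩
      · cases k with
        | zero => rfl
        | succ k => rw [forwardShift_apply_succ, ih1 k (by omega), mul_zero]
      · have h1 : (w (k + n) : ℂ) ≠ 0 := by exact_mod_cast (hpos (k + n)).ne'
        rw [← ih2, ← add_assoc, forwardShift_apply_succ, weightProd_succ, Complex.ofReal_mul]
        field_simp
  refine ContinuousLinearMap.opNorm_le_bound _ (by positivity) fun x =>
    lp.norm_le_of_forall_le (by positivity) fun k => ?_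
  rcases lt_or_ge k n with hk | hk
  · rw [(h1 n x).1 k hk, norm_zero]
    positivity
  · obtain ⟨k, rfl⟩ := Nat.exists_eq_add_of_le' hk
    have h2 := congrArg norm ((h1 n x).2 k)
    rw [norm_mul, norm_mul, Complex.norm_real, Complex.norm_real,
      Real.norm_of_nonneg (weightProd_pos hpos _).le,
      Real.norm_of_nonneg (weightProd_pos hpos _).le] at h2
    refine le_of_mul_le_mul_left ?_ (weightProd_pos hpos (k + n))
    rw [h2]
    have h3 : weightProd w k ≤ c⁻¹ * r⁻¹ ^ n * weightProd w (k + n) := by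
      have := h k n
      rw [inv_pow, ← mul_inv, ← div_eq_inv_mul, le_div_iff₀ (by positivity)]
      linarith
    calc _ ≤ c⁻¹ * r⁻¹ ^ n * weightProd w (k + n) * ‖x‖ := mul_le_mul h3
          (lp.norm_apply_le_norm ENNReal.top_ne_zero x _) (norm_nonneg _)
          ((weightProd_pos hpos _).le.trans h3)
      _ = _ := by ring

theorem forwardShift_mem_cZero {x : LInfty} (hx : x ∈ cZeroSubmodule) :
    forwardShift w hδ hw x ∈ cZeroSubmodule := by
  rw [mem_cZeroSubmodule, ← tendsto_add_atTop_iff_nat 1]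
  refine squeeze_zero_norm (a := fun n => δ⁻¹ * ‖x n‖) (fun n => ?_) ?_
  · rw [forwardShift_apply_succ, norm_mul, norm_inv, Complex.norm_real,
      Real.norm_of_nonneg (hδ.le.trans (hw n))]
    exact mul_le_mul_of_nonneg_right (inv_anti₀ hδ (hw n)) (norm_nonneg _)
  · have := (tendsto_zero_iff_norm_tendsto_zero.1 (mem_cZeroSubmodule.1 hx)).const_mul δ⁻¹
    rwa [mul_zero] at this

theorem weightedBackwardShift_mem_cZero {x : LInfty} (hx : x ∈ cZeroSubmodule) :
    weightedBackwardShift w hpos hbdd x ∈ cZeroSubmodule := by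
  rw [mem_cZeroSubmodule] at hx ⊢
  obtain ⟨K, hK⟩ := id hbdd
  refine squeeze_zero_norm (a := fun n => K * ‖x (n + 1)‖) (fun n => ?_) ?_
  · rw [weightedBackwardShift_apply, norm_mul, Complex.norm_real, Real.norm_of_nonneg (hpos n).le]
    exact mul_le_mul_of_nonneg_right (hK ⟨n, rfl⟩) (norm_nonneg _)
  · have := (tendsto_zero_iff_norm_tendsto_zero.1
      ((tendsto_add_atTop_iff_nat 1).2 hx)).const_mul K
    rwa [mul_zero] at this

theorem modCZero_weightedBackwardShift {x : LInfty} (hx : modCZero x = 0) :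
    modCZero (weightedBackwardShift w hpos hbdd x) = 0 :=
  modCZero_eq_zero_iff.2 (weightedBackwardShift_mem_cZero (modCZero_eq_zero_iff.1 hx))

theorem WeightsDecay.notMem_spectrum {lam : ℂ} (h : WeightsDecay w ‖lam‖) :
    lam ∉ spectrum ℂ (weightedBackwardShift w hpos hbdd) := by
  obtain ⟨r, C, hr, hrl, hC⟩ := h.exists_norm_pow_le (hpos := hpos) (hbdd := hbdd)
  intro hlam
  have := norm_le_of_mem_spectrum_of_eventually hr (Eventually.of_forall hC) hlam
  linarith

variable {Bq : ModCZero →L[ℂ] ModCZero}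
  (hBq : ∀ x, modCZero (weightedBackwardShift w hpos hbdd x) = Bq (modCZero x))

include hBq

theorem WeightsDecay.notMem_spectrum_modCZero {lam : ℂ} (h : WeightsDecay w ‖lam‖) :
    lam ∉ spectrum ℂ Bq := by
  obtain ⟨r, C, hr, hrl, hC⟩ := h.exists_norm_pow_le (hpos := hpos) (hbdd := hbdd)
  intro hlam
  have := isNormQuotient_modCZero.norm_le_of_mem_spectrum hBq hr hC hlam
  linarith

/-- On `l^∞` such a `lam` is an eigenvalue, but modulo `c_0` the forward shift is a two-sided
inverse of `B` whose powers are `O(r⁻¹ ^ n)` with `r > ‖lam‖`. -/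
theorem WeightsGrow.notMem_spectrum_modCZero {lam : ℂ} (h : WeightsGrow w ‖lam‖) :
    lam ∉ spectrum ℂ Bq := by
  obtain ⟨r, c, hr, hc, h⟩ := h
  have hr0 : 0 < r := (norm_nonneg _).trans_lt hr
  have hδ : 0 < c * r := by positivity
  have hw : ∀ n, c * r ≤ w n := fun n => by
    have := h n 1
    rw [weightProd_succ, pow_one, mul_comm (weightProd w n)] at this
    exact le_of_mul_le_mul_right this (weightProd_pos hpos n)
  intro hlam
  refine absurd (isNormQuotient_modCZero.le_norm_of_mem_spectrum hBq
    (S := forwardShift w hδ hw) (fun x hx => ?_) (fun x => ?_) (fun x => ?_) hr0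
    (norm_forwardShift_pow_le (hpos := hpos) hδ hw hr0 hc h) hlam) (not_le.2 hr)
  · exact modCZero_eq_zero_iff.2 (forwardShift_mem_cZero hδ hw (modCZero_eq_zero_iff.1 hx))
  · congr 1
    ext n
    have : (w n : ℂ) ≠ 0 := by exact_mod_cast (hpos n).ne'
    rw [weightedBackwardShift_apply, forwardShift_apply_succ, mul_inv_cancel_left₀ this]
  -- The backward shift loses only coordinate `0`, so the difference vanishes from index `1` on.
  · rw [← sub_eq_zero, ← map_sub, modCZero_eq_zero_iff, mem_cZeroSubmodule,
      ← tendsto_add_atTop_iff_nat 1]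
    refine tendsto_const_nhds.congr fun n => ?_
    have : (w n : ℂ) ≠ 0 := by exact_mod_cast (hpos n).ne'
    rw [lp.coeFn_sub, Pi.sub_apply, forwardShift_apply_succ, weightedBackwardShift_apply,
      inv_mul_cancel_left₀ this, sub_self]

end ForwardShift

theorem summable_norm_pow_mul_inv_pow {A : Type*} [NormedRing A] [NormedAlgebra ℂ A]
    [CompleteSpace A] {b : A} {R : ℝ} (hR : 0 < R) (hb : spectrum ℂ b ⊆ Metric.ball 0 R) :
    Summable fun n : ℕ => ‖b ^ n‖ * (R ^ n)⁻¹ := by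
  obtain ⟨q, hq0, hqR, hq⟩ := exists_eventually_norm_pow_le hR fun z hz => by simpa using hb hz
  refine Summable.of_norm_bounded_eventually_nat (g := fun n => (q / R) ^ n)
    (summable_geometric_of_lt_one (by positivity) ((div_lt_one hR).2 hqR)) ?_
  filter_upwards [hq] with n hn
  rw [Real.norm_of_nonneg (by positivity), div_pow, div_eq_mul_inv]
  exact mul_le_mul_of_nonneg_right hn (by positivity)

/-! ### Transfer from the shift to power series in it, and null orbits -/

section Eigen

variable {X : Type*} [NormedAddCommGroup X] [NormedSpace ℂ X] {b t : X →L[ℂ] X} {c : ℕ → ℂ}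

theorem pow_apply_eq_smul {v : X} {z : ℂ} (hv : b v = z • v) (n : ℕ) :
    (b ^ n) v = z ^ n • v := by
  induction n with
  | zero => simp
  | succ n ih => rw [pow_succ, mul_apply_eq_comp, hv, map_smul, ih, smul_smul, pow_succ']

theorem apply_eq_smul_of_hasSum {v : X} {z y : ℂ} (ht : HasSum (fun n => c n • b ^ n) t)
    (hv : b v = z • v) (hy : HasSum (fun n => c n * z ^ n) y) : t v = y • v := by
  refine HasSum.unique (f := fun n => (c n * z ^ n) • v) ?_ (hy.smul_const v)
  convert! (ContinuousLinearMap.apply ℂ X v).hasSum ht using 2 with n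
  change _ = c n • (b ^ n) v
  rw [pow_apply_eq_smul hv, smul_smul]

/-- Power series commute with intertwining operators. -/
theorem semiconj_of_hasSum {Y : Type*} [NormedAddCommGroup Y] [NormedSpace ℂ Y]
    {b' t' : Y →L[ℂ] Y} (ht : HasSum (fun n => c n • b ^ n) t)
    (ht' : HasSum (fun n => c n • b' ^ n) t') {q : X →L[ℂ] Y} (hq : ∀ x, q (b x) = b' (q x))
    (x : X) : q (t x) = t' (q x) := by
  have h1 := (q.comp (ContinuousLinearMap.apply ℂ X x)).hasSum ht
  have h2 := (ContinuousLinearMap.apply ℂ Y (q x)).hasSum ht'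
  refine HasSum.unique (f := fun n => c n • (b' ^ n) (q x)) ?_ h2
  convert! h1 using 2 with n
  change _ = q (c n • (b ^ n) x)
  rw [map_smul, apply_pow_eq_of_semiconj hq]

/-- An eigenvalue of the adjoint belongs to the spectrum. -/
theorem mem_spectrum_of_functional {φ : X →L[ℂ] ℂ} {v : X} (hv : φ v ≠ 0) {lam : ℂ}
    (hφ : ∀ y, φ (b y) = lam * φ y) : lam ∈ spectrum ℂ b := by
  intro hu
  obtain ⟨A, hA⟩ := (show IsUnit _ from hu).exists_right_inv
  have h1 := congrArg φ (DFunLike.congr_fun hA v)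
  rw [mul_apply_eq_comp, sub_apply, map_sub, hφ, Algebra.algebraMap_eq_smul_one, smul_apply,
    one_apply_eq_self, map_smul, smul_eq_mul, sub_self, one_apply_eq_self] at h1
  exact hv h1.symm

/-- The subspace of vectors with orbit tending to zero. -/
def nullOrbitSubmodule (t : X →L[ℂ] X) : Submodule ℂ X where
  carrier := {x | Tendsto (fun k : ℕ => (t ^ k) x) atTop (𝓝 0)}
  add_mem' {x y} hx hy := by
    have h : Tendsto (fun k : ℕ => (t ^ k) x + (t ^ k) y) atTop (𝓝 (0 + 0)) := Tendsto.add hx hy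
    simp only [← map_add, add_zero] at h
    exact h
  zero_mem' := by
    refine tendsto_const_nhds.congr fun k => ?_
    rw [map_zero]
  smul_mem' a x hx := by
    have h : Tendsto (fun k : ℕ => a • (t ^ k) x) atTop (𝓝 (a • 0)) := Tendsto.const_smul hx a
    simp only [← map_smul, smul_zero] at h
    exact h

theorem mem_nullOrbitSubmodule_of_eigen {v : X} {y : ℂ} (hy : ‖y‖ < 1) (hv : t v = y • v) :
    v ∈ nullOrbitSubmodule t := by
  have h := (tendsto_pow_atTop_nhds_zero_of_norm_lt_one hy).smul_const v
  rw [zero_smul] at h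
  exact h.congr fun k => (pow_apply_eq_smul hv k).symm

theorem topologicalClosure_nullOrbitSubmodule_subset (h0 : (0 : X) ∈ JVectors t) :
    ((nullOrbitSubmodule t).topologicalClosure : Set X) ⊆ JVectors t :=
  closure_minimal (fun _ hz => mem_JVectors_of_tendsto h0 hz) isClosed_JVectors

end Eigen

/-! ### The two inclusions -/

section Shift

variable {w : ℕ → ℝ} {hpos : ∀ n, 0 < w n} {hbdd : BddAbove (range w)} {f : ℂ → ℂ}
  {T : LInfty →L[ℂ] LInfty} {c : ℕ → ℂ}

/-- An eigenvalue of `f(B_w)` in the open unit disc, with growing weights, puts `c_0` inside the set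
of `J`-vectors. -/
theorem cZero_subset_JVectors (ht : HasSum (fun n => c n • weightedBackwardShift w hpos hbdd ^ n) T)
    {mu : ℂ} (hf : ∀ᶠ z in 𝓝 mu, HasSum (fun n => c n * z ^ n) (f z)) (hcont : ContinuousAt f mu)
    (hmu : ‖f mu‖ < 1) (hgrow : WeightsGrow w ‖mu‖) (h0 : (0 : LInfty) ∈ JVectors T) :
    cZero ⊆ JVectors T := by
  obtain ⟨r, κ, hr, hκ, hgrow⟩ := hgrow
  have hr0 : 0 < r := (norm_nonneg _).trans_lt hr
  have he := norm_eigenCoeff_le hpos hr0 hκ hgrow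
  set M := (nullOrbitSubmodule T).topologicalClosure
  have hM : IsClosed (M : Set LInfty) := Submodule.isClosed_topologicalClosure _
  -- By continuity `‖f z‖ < 1` near `mu`, so the eigenvector series takes values in `M` there; its
  -- coefficients are multiples of the unit vectors.
  have hmem : ∀ n, eigenCoeff w n ∈ M := by
    refine mem_of_eventually_tsum_pow_smul_mem he hr hM ?_
    filter_upwards [hf, hcont.norm.eventually_lt_const hmu,
      Metric.isOpen_ball.mem_nhds (mem_ball_zero_iff.2 hr)] with z hz hz1 hzr
    exact Submodule.le_topologicalClosure _ (mem_nullOrbitSubmodule_of_eigen hz1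
      (apply_eq_smul_of_hasSum ht (weightedBackwardShift_eigenVector
        (summable_pow_smul hr0 he (mem_ball_zero_iff.1 hzr))) hz))
  refine (cZero_subset_of_single_mem hM fun n => ?_).trans
    (topologicalClosure_nullOrbitSubmodule_subset h0)
  have hne : (weightProd w n : ℂ) ≠ 0 := by exact_mod_cast (weightProd_pos hpos n).ne'
  have := M.smul_mem (weightProd w n : ℂ) (hmem n)
  rwa [eigenCoeff, smul_inv_smul₀ hne] at this

/-- Growth and decay both exclude a point from the spectrum of the operator induced on `l^∞ / c_0`,
so only adjoint eigenvalues of `B` remain there, and `h` applies to them. -/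
theorem JVectors_subset_cZero (hc : Summable fun n => ‖c n‖ * ‖weightedBackwardShift w hpos hbdd ^ n‖)
    (ht : HasSum (fun n => c n • weightedBackwardShift w hpos hbdd ^ n) T)
    (hf : ∀ z ∈ spectrum ℂ (weightedBackwardShift w hpos hbdd), HasSum (fun n => c n * z ^ n) (f z))
    (hcont : ContinuousOn f (spectrum ℂ (weightedBackwardShift w hpos hbdd)))
    (h : ∀ (lam : ℂ) (φ : LInfty →L[ℂ] ℂ) (v : LInfty), φ v ≠ 0 →
      (∀ y, φ (weightedBackwardShift w hpos hbdd y) = lam * φ y) → 1 < ‖f lam‖) :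
    JVectors T ⊆ cZero := by
  obtain ⟨Bq, hBq⟩ := isNormQuotient_modCZero.exists_semiconj
    (S := weightedBackwardShift w hpos hbdd) fun _ => modCZero_weightedBackwardShift
  have hspec : ∀ z ∈ spectrum ℂ Bq, z ∈ spectrum ℂ (weightedBackwardShift w hpos hbdd) ∧
      1 < ‖f z‖ := by
    intro z hz
    rcases weights_trichotomy hpos hbdd z with hg | hd | ⟨φ, v, hv, hφ⟩
    · exact absurd hz (hg.notMem_spectrum_modCZero hBq)
    · exact absurd hz (hd.notMem_spectrum_modCZero hBq)
    · exact ⟨mem_spectrum_of_functional hv hφ, h z φ v hv hφ⟩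
  have hcq : Summable fun n => ‖c n‖ * ‖Bq ^ n‖ :=
    Summable.of_nonneg_of_le (fun n => by positivity) (fun n => mul_le_mul_of_nonneg_left
      (isNormQuotient_modCZero.norm_pow_le hBq n) (norm_nonneg _)) hc
  have htq : HasSum (fun n => c n • Bq ^ n) (∑' n, c n • Bq ^ n) :=
    (Summable.of_norm (hcq.congr fun n => (norm_smul _ _).symm)).hasSum
  obtain ⟨u, hu, hulim⟩ := exists_unit_tendsto_inv_pow hcq htq (fun z hz => hf z (hspec z hz).1)
    (hcont.mono fun z hz => (hspec z hz).1) fun z hz => (hspec z hz).2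
  intro x hx
  refine modCZero_eq_zero_iff.1 (apply_eq_zero_of_mem_JVectors (u := u) (fun y => ?_) hulim hx)
  rw [hu]
  exact semiconj_of_hasSum ht htq hBq y

/-- If `f(B_w)` is a `J`-class operator then `f` takes a value in the open unit disc on the
spectrum. -/
theorem exists_norm_lt_one_of_isJClass
    (hc : Summable fun n => ‖c n‖ * ‖weightedBackwardShift w hpos hbdd ^ n‖)
    (ht : HasSum (fun n => c n • weightedBackwardShift w hpos hbdd ^ n) T)
    (hf : ∀ z ∈ spectrum ℂ (weightedBackwardShift w hpos hbdd), HasSum (fun n => c n * z ^ n) (f z))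
    (hdiff : DifferentiableOn ℂ f (spectrum ℂ (weightedBackwardShift w hpos hbdd)))
    (h : ∀ (lam : ℂ) (φ : LInfty →L[ℂ] ℂ) (v : LInfty), φ v ≠ 0 →
      (∀ y, φ (weightedBackwardShift w hpos hbdd y) = lam * φ y) → 1 < ‖f lam‖)
    (hJ : IsJClass T) :
    ∃ z ∈ spectrum ℂ (weightedBackwardShift w hpos hbdd), ‖f z‖ < 1 := by
  by_contra! hge
  obtain ⟨x, hx0, hx⟩ := hJ
  obtain ⟨r, hr, hσ⟩ := exists_spectrum_weightedBackwardShift_eq w hpos hbdd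
  -- On the boundary circle growth would produce spectrum outside the disc and decay would remove
  -- `z` from it, so `z` is an adjoint eigenvalue.
  have hbdry : ∀ z : ℂ, ‖z‖ = r → 1 < ‖f z‖ := by
    intro z hz
    rcases weights_trichotomy hpos hbdd z with hg | hd | ⟨φ, v, hv, hφ⟩
    · obtain ⟨s, hs, hsp⟩ := hg.mem_spectrum (hpos := hpos) (hbdd := hbdd) (norm_nonneg z)
      obtain ⟨ρ, hρ1, hρ2⟩ := exists_between hs
      have hρ : ‖(ρ : ℂ)‖ = ρ := by
        rw [Complex.norm_real, Real.norm_of_nonneg ((norm_nonneg z).trans hρ1.le)]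
      have h1 := hsp ρ (by rwa [hρ])
      rw [hσ, mem_closedBall_zero_iff, hρ] at h1
      linarith
    · refine absurd ?_ (hd.notMem_spectrum (hpos := hpos) (hbdd := hbdd))
      rw [hσ, mem_closedBall_zero_iff, hz]
    · exact h z φ v hv hφ
  have hall : ∀ z ∈ spectrum ℂ (weightedBackwardShift w hpos hbdd), 1 < ‖f z‖ := by
    rw [hσ] at hge hdiff ⊢
    -- For `r = 0` the open ball is empty, but the disc is then its own boundary.
    rcases hr.eq_or_lt with rfl | hr0
    · intro z hz
      rw [Metric.closedBall_zero, mem_singleton_iff] at hz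
      exact hbdry z (by rw [hz, norm_zero])
    have hne : ∀ z ∈ Metric.closedBall (0 : ℂ) r, f z ≠ 0 := fun z hz h0 => by
      have := hge z hz
      rw [h0, norm_zero] at this
      linarith
    have hcl : closure (Metric.ball (0 : ℂ) r) = Metric.closedBall 0 r := closure_ball _ hr0.ne'
    -- The assumption `‖f‖ ≥ 1` keeps `f` free of zeros, so `1 / f` attains its maximum modulus over
    -- the disc on the boundary.
    obtain ⟨z₀, hz₀, hmax⟩ := Complex.exists_mem_frontier_isMaxOn_norm (Metric.isBounded_ball)
      (Metric.nonempty_ball.2 hr0) (f := fun z => (f z)⁻¹)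
      (DifferentiableOn.diffContOnCl (s := Metric.ball (0 : ℂ) r) (by rw [hcl]; exact hdiff.inv hne))
    rw [frontier_ball _ hr0.ne', mem_sphere_zero_iff_norm] at hz₀
    intro z hz
    have h1 := hmax (hcl.symm ▸ hz)
    simp only [Function.comp_apply, mem_ofPred_eq, norm_inv] at h1
    rw [inv_le_inv₀ (norm_pos_iff.2 (hne z hz))
      (norm_pos_iff.2 (hne z₀ (mem_closedBall_zero_iff.2 hz₀.le)))] at h1
    exact (hbdry z₀ hz₀).trans_le h1
  obtain ⟨u, hu, hulim⟩ := exists_unit_tendsto_inv_pow hc ht hf hdiff.continuousOn hall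
  exact hx0 (apply_eq_zero_of_mem_JVectors (u := u) (q := ContinuousLinearMap.id ℂ LInfty)
    (fun y => by rw [hu]; rfl) hulim hx)

end Shift

theorem theorem3p17 (w : ℕ → ℝ) (hpos : ∀ n, 0 < w n) (hbdd : BddAbove (Set.range w))
    (U : Set ℂ) (hU : IsOpen U)
    (hσU : spectrum ℂ (weightedBackwardShift w hpos hbdd) ⊆ U)
    (f : ℂ → ℂ) (hf : DifferentiableOn ℂ f U)
    (R : ℝ) (hσR : spectrum ℂ (weightedBackwardShift w hpos hbdd) ⊆ Metric.ball 0 R)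
    (hRU : Metric.closedBall 0 R ⊆ U)
    (hJ : IsJClass (rieszDunford f (weightedBackwardShift w hpos hbdd) R)) :
    JVectors (rieszDunford f (weightedBackwardShift w hpos hbdd) R) = cZero := by
  have : Nontrivial LInfty := nontrivial_LInfty
  have hR : 0 < R := by
    obtain ⟨z, hz⟩ := spectrum.nonempty (weightedBackwardShift w hpos hbdd)
    exact (norm_nonneg z).trans_lt (mem_ball_zero_iff.1 (hσR hz))
  obtain ⟨hc, ht⟩ := hasSum_cauchyCoeff_smul_pow hR
    (hf.continuousOn.mono (Metric.sphere_subset_closedBall.trans hRU))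
    (summable_norm_pow_mul_inv_pow hR hσR)
  change HasSum _ (rieszDunford f (weightedBackwardShift w hpos hbdd) R) at ht
  have hfs : ∀ z : ℂ, ‖z‖ < R → HasSum (fun n => cauchyCoeff f R n * z ^ n) (f z) :=
    fun z hz => hasSum_cauchyCoeff_mul_pow hR (hf.mono hRU) hz
  have hfs' := fun z hz => hfs z (mem_ball_zero_iff.1 (hσR hz))
  have hJ' := hJ
  obtain ⟨x, -, hx⟩ := hJ'
  have heig : ∀ (lam : ℂ) (φ : LInfty →L[ℂ] ℂ) (v : LInfty), φ v ≠ 0 →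
      (∀ y, φ (weightedBackwardShift w hpos hbdd y) = lam * φ y) → 1 < ‖f lam‖ := by
    intro lam φ v hv hφ
    have hlam := mem_spectrum_of_functional hv hφ
    -- An adjoint eigenvector intertwines `B` with multiplication by `lam` on `ℂ`; the same power
    -- series then intertwines `T` with multiplication by `f lam`.
    have hscal : HasSum (fun n => cauchyCoeff f R n • (lam • ContinuousLinearMap.id ℂ ℂ) ^ n)
        (f lam • ContinuousLinearMap.id ℂ ℂ) := by
      convert! (hfs' lam hlam).smul_const (ContinuousLinearMap.id ℂ ℂ) using 2 with n
      rw [smul_pow, ← ContinuousLinearMap.one_def, one_pow, smul_smul]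
    exact one_lt_norm_of_functional hx hv fun y => semiconj_of_hasSum ht hscal hφ y
  refine Subset.antisymm
    (JVectors_subset_cZero hc ht hfs' (hf.continuousOn.mono hσU) heig) ?_
  obtain ⟨mu, hmu, hfmu⟩ := exists_norm_lt_one_of_isJClass hc ht hfs' (hf.mono hσU) heig hJ
  refine cZero_subset_JVectors ht ?_ (hf.continuousOn.continuousAt (hU.mem_nhds (hσU hmu))) hfmu ?_
    (zero_mem_JVectors hx)
  · filter_upwards [Metric.isOpen_ball.mem_nhds (hσR hmu)] with z hz
    exact hfs z (mem_ball_zero_iff.1 hz)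
  · rcases weights_trichotomy hpos hbdd mu with hg | hd | ⟨φ, v, hv, hφ⟩
    · exact hg
    · exact absurd hmu hd.notMem_spectrum
    · exact absurd (heig mu φ v hv hφ) (not_lt.2 hfmu.le)
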